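/- Let $\tau:[0,1]\to[0,1]$ be continuous and surjective, and let $0=a_0<a_1<\dots<a_q=1$ be a partition such that $\tau$ is strictly monotonic on each interval $(a_{i-1},a_i)$, $1\le i\le q$ (the partition need not be the coarsest one with this property). **The dimension module.** Let $C=\{a_0,\dots,a_q\}$ and let $I_1\subset[0,1]$ be the smallest set that contains $C$ and is closed under $\tau$ and $\tau^{-1}$. Let $X$ be the totally ordered set obtained from $[0,1]$ by replacing each point $x\in I_1\setminus\{0,1\}$ by two points $x^-<x^+$ (and put $x^-=x^+=x$ for all other $x$), with the order topology, and let $\pi:X\to[0,1]$ be the collapse map. Let $\sigma:X\to X$ be the unique continuous map with $\pi\circ\sigma=\tau\circ\pi$. On the group $C(X,\mathbb Z)$ of continuous functions $X\to\mathbb Z$ define $(\mathcal L f)(x)=\sum_{\sigma(y)=x}f(y)$. Let $DG(\tau)$ be the abelian group of equivalence classes $[f]$ of $f\in C(X,\mathbb Z)$, where $f\sim g$ if $\mathcal L^nf=\mathcal L^ng$ for some $n\ge0$. Since $\tau$ is surjective, $\mathcal L_*[f]=[\mathcal Lf]$ defines an automorphism $\mathcal L_*$ of $DG(\tau)$, and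 $DG(\tau)$ is a $\mathbb Z[t,t^{-1}]$-module with $t$ acting as $\mathcal L_*$. For $c<d$ in $I_1$ let $I(c,d)\in DG(\tau)$ be the class of the characteristic function of the clopen order interval $\{x\in X: c^+\le x\le d^-\}$. **Proposition 1.53.** Assume that the orbits $\{\tau^n(a_i): n\ge 0\}$ of $a_1,\dots,a_{q-1}$ are infinite and pairwise disjoint, and that $\tau(\{0,1\})\cap\{0,1\}=\emptyset$. Then $DG(\tau)\cong(\mathbb Z[t,t^{-1}])^{q-1}$ as (unordered) $\mathbb Z[t,t^{-1}]$-modules, and $I(a_0,a_1),I(a_1,a_2),\dots,I(a_{q-2},a_{q-1})$ is a basis of the module $DG(\tau)$. -/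

import Mathlib

open Set Function Topology
open scoped LaurentPolynomial

noncomputable section

/-! ### The disconnection of `[0,1]` at the points of a set -/

/-- The disconnection of `I = [0,1]` at the points of `D`: the copy of `I` in which every point
`x ∈ D \ {0,1}` is replaced by two points `x⁻ < x⁺`. Here `x⁻` is the pair `(x, false)` and `x⁺` is
the pair `(x, true)`, ordered lexicographically; a point `x ∉ D \ {0,1}` is the pair `(x, false)`. -/
def Disconnection (D : Set unitInterval) : Type :=
  {p : unitInterval ×ₗ Bool // (ofLex p).2 = true → (ofLex p).1 ∈ D \ {0, 1}}

namespace Disconnection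

variable {D : Set unitInterval}

instance : LinearOrder (Disconnection D) :=
  inferInstanceAs (LinearOrder
    {p : unitInterval ×ₗ Bool // (ofLex p).2 = true → (ofLex p).1 ∈ D \ {0, 1}})

/-- The disconnection carries its own order topology. -/
instance : TopologicalSpace (Disconnection D) := Preorder.topology _

instance : OrderTopology (Disconnection D) := ⟨rfl⟩

/-- The collapse map `π : X → I`. -/
def collapse (y : Disconnection D) : unitInterval := (ofLex y.1).1

/-- `flag y` tells whether `y` is the upper one of two points with the same image under `π`. -/
def flag (y : Disconnection D) : Bool := (ofLex y.1).2

/-- `x⁻`, the smallest point of `π⁻¹(x)`. -/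
def lower (D : Set unitInterval) (x : unitInterval) : Disconnection D := ⟨toLex (x, false), fun h => by simp at h⟩

open Classical in
/-- `x⁺`, the largest point of `π⁻¹(x)`; it differs from `x⁻` exactly if `x ∈ D \ {0,1}`. -/
def upper (D : Set unitInterval) (x : unitInterval) : Disconnection D :=
  ⟨toLex (x, decide (x ∈ D \ {0, 1})), fun h => by simpa using h⟩

@[simp] lemma collapse_lower (x : unitInterval) : collapse (lower D x) = x := rfl
@[simp] lemma collapse_upper (x : unitInterval) : collapse (upper D x) = x := rfl
@[simp] lemma flag_lower (x : unitInterval) : flag (lower D x) = false := rfl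
open Classical in
@[simp] lemma flag_upper (x : unitInterval) : flag (upper D x) = decide (x ∈ D \ {0, 1}) := rfl

lemma mem_of_flag (y : Disconnection D) (h : flag y = true) : collapse y ∈ D \ {0, 1} := y.2 h

lemma ext' {y z : Disconnection D} (h : collapse y = collapse z) (h' : flag y = flag z) : y = z :=
  Subtype.ext (ofLex.injective (Prod.ext h h'))

lemma lt_iff' {y z : Disconnection D} :
    y < z ↔ collapse y < collapse z ∨
      collapse y = collapse z ∧ flag y = false ∧ flag z = true := by
  have h : y < z ↔ y.1 < z.1 := Iff.rfl
  rw [h, Prod.Lex.lt_iff, Bool.lt_iff]; rfl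

lemma le_lower {y : Disconnection D} {x : unitInterval} :
    y ≤ lower D x ↔ collapse y < x ∨ collapse y = x ∧ flag y = false := by
  rw [← not_lt, lt_iff']
  simp only [collapse_lower, flag_lower, true_and]
  rcases lt_trichotomy (collapse y) x with h | h | h
  · simp [h, h.le, h.ne']
  · simp [h]
  · simp [h, h.not_gt, h.ne']

lemma upper_le {y : Disconnection D} {x : unitInterval} :
    upper D x ≤ y ↔ x < collapse y ∨ x = collapse y ∧ (x ∈ D \ {0, 1} → flag y = true) := by
  rw [← not_lt, lt_iff']
  simp only [collapse_upper, flag_upper, decide_eq_true_eq]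
  rcases lt_trichotomy (collapse y) x with h | h | h
  · simp only [h, true_or, not_true_eq_false, h.not_gt, h.ne', false_and, or_false]
  · simp only [h, lt_irrefl, true_and, false_or]
    cases flag y <;> simp
  · simp [h, h.le, h.ne']

lemma lower_eq_upper {x : unitInterval} (h : x ∉ D \ {0, 1}) : lower D x = upper D x :=
  ext' rfl (by simp only [flag_lower, flag_upper, h, decide_false])

lemma isOpen_Ici_upper {x : unitInterval} (hx : x ∈ D) (h1 : x < 1) : IsOpen (Ici (upper D x)) := by
  by_cases hD : x ∈ D \ {0, 1}
  · have : Ici (upper D x) = Ioi (lower D x) := by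
      ext y
      rw [mem_Ici, mem_Ioi, upper_le, lt_iff']
      simp [hD.1, show x ≠ 0 ∧ x ≠ 1 by simpa using hD.2]
    rw [this]; exact isOpen_Ioi
  · have h0 : x = 0 := by
      by_contra h0
      exact hD ⟨hx, by simp [h0, h1.ne]⟩
    have : Ici (upper D x) = univ := by
      refine eq_univ_of_forall fun y => ?_
      rw [mem_Ici, upper_le]
      rcases (show x ≤ collapse y from h0 ▸ unitInterval.nonneg').lt_or_eq with h | h
      · exact Or.inl h
      · exact Or.inr ⟨h, fun h' => absurd h' hD⟩
    rw [this]; exact isOpen_univ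

lemma isOpen_Iic_lower {x : unitInterval} (hx : x ∈ D) (h0 : 0 < x) : IsOpen (Iic (lower D x)) := by
  by_cases hD : x ∈ D \ {0, 1}
  · have : Iic (lower D x) = Iio (upper D x) := by
      ext y
      rw [mem_Iic, mem_Iio, le_lower, lt_iff']
      simp [hD.1, show x ≠ 0 ∧ x ≠ 1 by simpa using hD.2]
    rw [this]; exact isOpen_Iio
  · have h1 : x = 1 := by
      by_contra h1
      exact hD ⟨hx, by simp [h0.ne', h1]⟩
    have : Iic (lower D x) = univ := by
      refine eq_univ_of_forall fun y => ?_
      rw [mem_Iic, le_lower]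
      rcases (show collapse y ≤ x from h1 ▸ unitInterval.le_one').lt_or_eq with h | h
      · exact Or.inl h
      · refine Or.inr ⟨h, ?_⟩
        by_contra hf
        exact hD (h ▸ mem_of_flag y (by simpa using hf))
    rw [this]; exact isOpen_univ

/-- The order interval `[x⁺, y⁻]` is clopen for `x < y` in `D`. -/
lemma isClopen_Icc {x y : unitInterval} (hx : x ∈ D) (hy : y ∈ D) (h : x < y) :
    IsClopen (Icc (upper D x) (lower D y)) :=
  ⟨isClosed_Icc, (isOpen_Ici_upper hx (h.trans_le unitInterval.le_one')).inter
    (isOpen_Iic_lower hy (unitInterval.nonneg'.trans_lt h))⟩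

/-- The characteristic function in `C(X, ℤ)` of the order interval `I(x, y) = [x⁺, y⁻]`,
for `x < y` in `D`. -/
def intervalChar {x y : unitInterval} (hx : x ∈ D) (hy : y ∈ D) (h : x < y) : C(Disconnection D, ℤ) :=
  ⟨(Icc (upper D x) (lower D y)).indicator 1,
    (isClopen_Icc hx hy h).continuous_indicator continuous_const⟩

end Disconnection

/-! ### Piecewise homeomorphisms, the transfer map and the group `G_σ` -/

/-- A piecewise homeomorphism: a continuous open map for which the space has a finite partition into
clopen sets, each mapped homeomorphically onto its image. (The restriction of a continuous open map
to an open set is a homeomorphism onto its image as soon as it is injective. That the images are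
closed is automatic on the compact Hausdorff spaces for which the notion is used.) -/
structure IsPiecewiseHomeo {X : Type*} [TopologicalSpace X] (σ : X → X) : Prop where
  continuous : Continuous σ
  isOpenMap : IsOpenMap σ
  exists_partition : ∃ (n : ℕ) (P : Fin n → Set X), (∀ i, IsClopen (P i)) ∧
    Pairwise (Disjoint on P) ∧ ⋃ i, P i = univ ∧ ∀ i, InjOn σ (P i) ∧ IsClosed (σ '' P i)

/-- The transfer map `(L f)(x) = ∑_{σ(y) = x} f(y)` of a finitely-many-to-one map. -/
def transferFun {X : Type*} (σ : X → X) (f : X → ℤ) (x : X) : ℤ := ∑ᶠ y : σ ⁻¹' {x}, f y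

/-- If `σ` is injective on `E`, then `L` of a function that vanishes off `E` is given by the
values at the preimages in `E`. -/
lemma transferFun_of_injOn {X : Type*} {σ : X → X} {E : Set X} (hE : InjOn σ E) {f : X → ℤ} (hf : ∀ y ∉ E, f y = 0)
    {y : X} (hy : y ∈ E) : transferFun σ f (σ y) = f y := by
  refine finsum_eq_single (fun z : σ ⁻¹' {σ y} => f z) ⟨y, rfl⟩ ?_
  rintro ⟨z, hz⟩ hne
  refine hf z fun hzE => hne ?_
  exact Subtype.ext (hE hzE hy hz)

lemma transferFun_of_notMem {X : Type*} {σ : X → X} {E : Set X} {f : X → ℤ} (hf : ∀ y ∉ E, f y = 0)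
    {x : X} (hx : x ∉ σ '' E) : transferFun σ f x = 0 := by
  refine finsum_eq_zero_of_forall_eq_zero ?_
  rintro ⟨z, hz⟩
  exact hf z fun hzE => hx ⟨z, hzE, hz⟩

namespace IsPiecewiseHomeo

variable {X : Type*} [TopologicalSpace X] {σ : X → X}

lemma finite_fiber (hσ : IsPiecewiseHomeo σ) (x : X) : (σ ⁻¹' {x}).Finite := by
  obtain ⟨n, P, -, -, hcov, hP⟩ := hσ.exists_partition
  have : σ ⁻¹' {x} = ⋃ i, (P i ∩ σ ⁻¹' {x}) := by
    rw [← iUnion_inter, hcov, univ_inter]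
  rw [this]
  refine finite_iUnion fun i => Set.Subsingleton.finite ?_
  intro y hy z hz
  exact (hP i).1 hy.1 hz.1 (hy.2.trans hz.2.symm)

lemma transferFun_add (hσ : IsPiecewiseHomeo σ) (f g : X → ℤ) :
    transferFun σ (f + g) = transferFun σ f + transferFun σ g := by
  funext x
  have := (hσ.finite_fiber x).to_subtype
  exact finsum_add_distrib (Set.toFinite _) (Set.toFinite _)

lemma continuous_transferFun (hσ : IsPiecewiseHomeo σ) {f : X → ℤ} (hf : Continuous f) :
    Continuous (transferFun σ f) := by
  classical
  obtain ⟨n, P, hclopen, hdisj, hcov, hP⟩ := hσ.exists_partition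
  have hsum : f = ∑ i, (P i).indicator f := by
    funext x
    obtain ⟨i, hi⟩ := mem_iUnion.1 (hcov.symm ▸ mem_univ x : x ∈ ⋃ i, P i)
    rw [Finset.sum_apply, Finset.sum_eq_single i]
    · rw [indicator_of_mem hi]
    · intro j _ hj
      exact indicator_of_notMem (fun hx => (hdisj hj).le_bot ⟨hx, hi⟩) _
    · simp
  have hL : transferFun σ f = ∑ i, transferFun σ ((P i).indicator f) := by
    conv_lhs => rw [hsum]
    exact map_sum (⟨⟨transferFun σ, by funext x; simp [transferFun]⟩,
      hσ.transferFun_add⟩ : (X → ℤ) →+ (X → ℤ)) _ _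
  rw [hL]
  rw [show (∑ i, transferFun σ ((P i).indicator f)) =
    fun x => ∑ i, transferFun σ ((P i).indicator f) x from funext fun x => Finset.sum_apply _ _ _]
  refine continuous_finsetSum _ fun i _ => ?_
  have hz : ∀ y ∉ P i, (P i).indicator f y = 0 := fun y hy => indicator_of_notMem hy _
  have hloc : IsLocallyConstant (transferFun σ ((P i).indicator f)) := by
    rw [IsLocallyConstant.iff_exists_open]
    intro x
    by_cases hx : x ∈ σ '' P i
    · obtain ⟨y, hy, rfl⟩ := hx
      refine ⟨σ '' (P i ∩ f ⁻¹' {f y}), hσ.isOpenMap _ ((hclopen i).2.inter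
        ((isOpen_discrete _).preimage hf)), ⟨y, ⟨hy, rfl⟩, rfl⟩, ?_⟩
      rintro _ ⟨z, ⟨hz1, hz2⟩, rfl⟩
      rw [transferFun_of_injOn (hP i).1 hz hz1, transferFun_of_injOn (hP i).1 hz hy,
        indicator_of_mem hz1, indicator_of_mem hy]
      exact hz2
    · refine ⟨(σ '' P i)ᶜ, (hP i).2.isOpen_compl, hx, fun x' hx' => ?_⟩
      rw [transferFun_of_notMem hz hx', transferFun_of_notMem hz hx]
  exact hloc.continuous

/-- The transfer map as an endomorphism of `C(X, ℤ)`. -/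
def transfer (hσ : IsPiecewiseHomeo σ) : C(X, ℤ) →+ C(X, ℤ) where
  toFun f := ⟨transferFun σ f, hσ.continuous_transferFun f.continuous⟩
  map_zero' := by ext x; simp [transferFun]
  map_add' f g := by ext x; exact congrFun (hσ.transferFun_add f g) x

lemma transfer_surjective (hσ : IsPiecewiseHomeo σ) (hs : Surjective σ) :
    Surjective hσ.transfer := by
  intro f
  obtain ⟨n, P, hclopen, hdisj, hcov, hP⟩ := hσ.exists_partition
  have himg : ∀ i, IsClopen (σ '' P i) := fun i => ⟨(hP i).2, hσ.isOpenMap _ (hclopen i).2⟩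
  let E : Set X := ⋃ i, P i ∩ ⋂ j : {j : Fin n // j < i}, (σ ⁻¹' (σ '' P j))ᶜ
  have hEc : IsClopen E := isClopen_iUnion_of_finite fun i => (hclopen i).inter
    (isClopen_iInter_of_finite fun j => ((himg j).preimage hσ.continuous).compl)
  have hmem : ∀ {y}, y ∈ E → ∃ i, y ∈ P i ∧ ∀ j < i, σ y ∉ σ '' P j := by
    intro y hy
    obtain ⟨i, h1, h2⟩ := mem_iUnion.1 hy
    refine ⟨i, h1, fun j hj => ?_⟩
    simpa using mem_iInter.1 h2 ⟨j, hj⟩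
  have hinj : InjOn σ E := by
    intro y hy z hz hyz
    obtain ⟨i, hi, hi'⟩ := hmem hy
    obtain ⟨j, hj, hj'⟩ := hmem hz
    have hij : i = j := by
      rcases lt_trichotomy i j with h | h | h
      · exact absurd ⟨y, hi, hyz⟩ (hj' i h)
      · exact h
      · exact absurd ⟨z, hj, hyz.symm⟩ (hi' j h)
    subst hij
    exact (hP i).1 hi hj hyz
  have hEs : ∀ x, ∃ y ∈ E, σ y = x := by
    intro x
    obtain ⟨y, rfl⟩ := hs x
    obtain ⟨i₀, hi₀⟩ := mem_iUnion.1 (hcov.symm ▸ mem_univ y : y ∈ ⋃ i, P i)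
    obtain ⟨i, ⟨⟨z, hz, hzy⟩, hmin⟩⟩ := exists_minimal_of_wellFoundedLT
      (fun i => σ y ∈ σ '' P i) ⟨i₀, y, hi₀, rfl⟩
    refine ⟨z, mem_iUnion.2 ⟨i, hz, mem_iInter.2 ?_⟩, hzy⟩
    rintro ⟨j, hj⟩ h
    have h' : σ y ∈ σ '' P j := by rw [← hzy]; exact h
    exact absurd (hmin h' hj.le) (not_le.2 hj)
  refine ⟨⟨E.indicator (f ∘ σ), hEc.continuous_indicator (f.continuous.comp hσ.continuous)⟩, ?_⟩
  ext x
  obtain ⟨y, hy, rfl⟩ := hEs x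
  change transferFun σ (E.indicator (f ∘ σ)) (σ y) = f (σ y)
  rw [transferFun_of_injOn hinj (fun z hz => indicator_of_notMem hz _) hy, indicator_of_mem hy]
  rfl

/-- The functions `f` with `Lⁿ f = 0` for some `n ≥ 0`. -/
def eventualKer (hσ : IsPiecewiseHomeo σ) : AddSubgroup C(X, ℤ) where
  carrier := {f | ∃ n : ℕ, hσ.transfer^[n] f = 0}
  zero_mem' := ⟨0, rfl⟩
  add_mem' := by
    rintro f g ⟨m, hm⟩ ⟨n, hn⟩
    refine ⟨m + n, ?_⟩
    rw [iterate_map_add, add_comm m n, iterate_add_apply, hm, add_comm n m, iterate_add_apply, hn]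
    simp
  neg_mem' := by
    rintro f ⟨n, hn⟩
    exact ⟨n, by rw [iterate_map_neg, hn, neg_zero]⟩

/-- The group `G_σ` of equivalence classes of `C(X, ℤ)` under the relation `f ∼ g` iff
`Lⁿ f = Lⁿ g` for some `n ≥ 0`. -/
def DimensionGroup (hσ : IsPiecewiseHomeo σ) : Type _ := C(X, ℤ) ⧸ hσ.eventualKer

instance (hσ : IsPiecewiseHomeo σ) : AddCommGroup hσ.DimensionGroup :=
  inferInstanceAs (AddCommGroup (C(X, ℤ) ⧸ hσ.eventualKer))

/-- The class `[f]` of `f` in `G_σ`. -/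
def cls (hσ : IsPiecewiseHomeo σ) : C(X, ℤ) →+ hσ.DimensionGroup :=
  QuotientAddGroup.mk' hσ.eventualKer

lemma cls_eq_cls (hσ : IsPiecewiseHomeo σ) {f g : C(X, ℤ)} :
    hσ.cls f = hσ.cls g ↔ ∃ n : ℕ, hσ.transfer^[n] f = hσ.transfer^[n] g := by
  rw [← sub_eq_zero, ← map_sub]
  refine (QuotientAddGroup.eq_zero_iff (f - g)).trans (exists_congr fun n => ?_)
  rw [iterate_map_sub, sub_eq_zero]

lemma cls_surjective (hσ : IsPiecewiseHomeo σ) : Surjective hσ.cls :=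
  QuotientAddGroup.mk'_surjective _

/-- The endomorphism `L_*` of `G_σ` given by `L_* [f] = [L f]`. -/
def transferStar (hσ : IsPiecewiseHomeo σ) : hσ.DimensionGroup →+ hσ.DimensionGroup :=
  QuotientAddGroup.map hσ.eventualKer hσ.eventualKer hσ.transfer (by
    rintro f ⟨n, hn⟩
    exact ⟨n, by rw [← iterate_succ_apply, iterate_succ_apply', hn, map_zero]⟩)

@[simp] lemma transferStar_cls (hσ : IsPiecewiseHomeo σ) (f : C(X, ℤ)) :
    hσ.transferStar (hσ.cls f) = hσ.cls (hσ.transfer f) := rfl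

lemma transferStar_bijective (hσ : IsPiecewiseHomeo σ) (hs : Surjective σ) :
    Bijective hσ.transferStar := by
  constructor
  · intro x y h
    obtain ⟨f, rfl⟩ := hσ.cls_surjective x
    obtain ⟨g, rfl⟩ := hσ.cls_surjective y
    rw [transferStar_cls, transferStar_cls, cls_eq_cls] at h
    obtain ⟨n, hn⟩ := h
    exact hσ.cls_eq_cls.2 ⟨n + 1, hn⟩
  · intro y
    obtain ⟨g, rfl⟩ := hσ.cls_surjective y
    obtain ⟨f, rfl⟩ := hσ.transfer_surjective hs g
    exact ⟨hσ.cls f, rfl⟩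

/-- For surjective `σ`, the map `L_*` as a unit of the endomorphism ring of `G_σ`. -/
def transferUnit (hσ : IsPiecewiseHomeo σ) (hs : Surjective σ) :
    (Module.End ℤ hσ.DimensionGroup)ˣ :=
  LinearMap.GeneralLinearGroup.ofLinearEquiv
    (AddEquiv.ofBijective hσ.transferStar (hσ.transferStar_bijective hs)).toIntLinearEquiv

/-- For surjective `σ`, the group `G_σ` is a `ℤ[t,t⁻¹]`-module through
`(∑ zᵢ tⁱ) [f] = (∑ zᵢ (L_*)ⁱ) [f]`. -/
@[reducible] def dimensionModule (hσ : IsPiecewiseHomeo σ) (hs : Surjective σ) :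
    Module ℤ[T;T⁻¹] hσ.DimensionGroup :=
  Module.compHom hσ.DimensionGroup (AddMonoidAlgebra.lift ℤ (Module.End ℤ hσ.DimensionGroup) ℤ
    ((Units.coeHom _).comp (zpowersHom _ (hσ.transferUnit hs)))).toRingHom

/-- The variable `t` acts as `L_*`. -/
lemma T_one_smul (hσ : IsPiecewiseHomeo σ) (hs : Surjective σ) (x : hσ.DimensionGroup) :
    letI := hσ.dimensionModule hs
    (LaurentPolynomial.T 1 : ℤ[T;T⁻¹]) • x = hσ.transferStar x := by
  change (AddMonoidAlgebra.lift ℤ (Module.End ℤ hσ.DimensionGroup) ℤ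
    ((Units.coeHom _).comp (zpowersHom _ (hσ.transferUnit hs))))
      (AddMonoidAlgebra.single 1 1) x = _
  rw [AddMonoidAlgebra.lift_single]
  simp [zpowersHom_apply]
  rfl

end IsPiecewiseHomeo

/-! ### Multimodal maps -/

/-- A multimodal map, i.e. a continuous piecewise monotonic map `τ : [0,1] → [0,1]`, together with
an associated partition `0 = a₀ < a₁ < ⋯ < a_q = 1`, which need not be the coarsest one: `τ` is
strictly monotonic on each of the intervals `(a_{i-1}, a_i)`. -/
structure MultimodalMap (q : ℕ) where
  toFun : unitInterval → unitInterval
  continuous_toFun : Continuous toFun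
  a : Fin (q + 1) → unitInterval
  a_strictMono : StrictMono a
  a_zero : a 0 = 0
  a_last : a (Fin.last q) = 1
  monotonic : ∀ i : Fin q, StrictMonoOn toFun (Ioo (a i.castSucc) (a i.succ)) ∨
    StrictAntiOn toFun (Ioo (a i.castSucc) (a i.succ))

/-- The (forward) orbit `{τⁿ x | n ≥ 0}` of a point. -/
def forwardOrbit {Y : Type*} (f : Y → Y) (x : Y) : Set Y := range fun n : ℕ => f^[n] x

namespace MultimodalMap

variable {q : ℕ} (τ : MultimodalMap q)

/-- The generalized orbit `I₁` of the partition: the smallest subset of `[0,1]` that contains the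
partition points and is closed under `τ` and `τ⁻¹`. -/
def generalizedOrbit : Set unitInterval :=
  ⋂₀ {S | range τ.a ⊆ S ∧ τ.toFun '' S ⊆ S ∧ τ.toFun ⁻¹' S ⊆ S}

/-- The space `X`: the disconnection of `[0,1]` at the points of the generalized orbit. -/
abbrev Space : Type := Disconnection τ.generalizedOrbit

open Disconnection

/-- The set `[a_{i-1}⁺, a_i⁻]` in `X`. -/
def piece (i : Fin q) : Set τ.Space :=
  Icc (upper _ (τ.a i.castSucc)) (lower _ (τ.a i.succ))

open Classical in
/-- The local homeomorphism `σ : X → X` associated with `τ`. Let `y ∈ [a_{i-1}⁺, a_i⁻]` and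
`x = π(y)`. Call `y` a right point if `y = x⁺ ≠ x⁻` or `y = 0`. If `τ` increases on
`(a_{i-1}, a_i)`, then `σ(y)` is `τ(x)⁺` for a right point and `τ(x)⁻` for any other point; if `τ`
decreases, then it is the other way round. (If `x ∉ I₁` then `τ(x) ∉ I₁` and both values agree.)
This is the only continuous map `σ` with `π ∘ σ = τ ∘ π`. -/
def localHomeo (y : τ.Space) : τ.Space :=
  if (∃ i, y ∈ τ.piece i ∧ StrictMonoOn τ.toFun (Ioo (τ.a i.castSucc) (τ.a i.succ))) ↔
      (y.flag = true ∨ y.collapse = 0)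
  then upper _ (τ.toFun y.collapse) else lower _ (τ.toFun y.collapse)

lemma collapse_localHomeo (y : τ.Space) :
    (τ.localHomeo y).collapse = τ.toFun y.collapse := by
  unfold localHomeo; split_ifs <;> rfl

lemma a_mem (i : Fin (q + 1)) : τ.a i ∈ τ.generalizedOrbit :=
  mem_sInter.2 fun _ hS => hS.1 (mem_range_self i)

lemma map_mem {x : unitInterval} (hx : x ∈ τ.generalizedOrbit) :
    τ.toFun x ∈ τ.generalizedOrbit :=
  mem_sInter.2 fun S hS => hS.2.1 (mem_image_of_mem _ (mem_sInter.1 hx S hS))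

lemma mem_of_map_mem {x : unitInterval} (hx : τ.toFun x ∈ τ.generalizedOrbit) :
    x ∈ τ.generalizedOrbit :=
  mem_sInter.2 fun S hS => hS.2.2 (mem_sInter.1 hx S hS)

lemma a_lt (i : Fin q) : τ.a i.castSucc < τ.a i.succ := τ.a_strictMono i.castSucc_lt_succ

/-- A continuous function that is strictly increasing on an open interval is strictly increasing
on its closure. -/
lemma strictMonoOn_Icc_of_Ioo {β : Type*} [LinearOrder β] [TopologicalSpace β] [OrderTopology β]
    {f : unitInterval → β} (hf : Continuous f) {a b : unitInterval}
    (h : StrictMonoOn f (Ioo a b)) : StrictMonoOn f (Icc a b) := by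
  intro x hx y hy hxy
  obtain ⟨u, hxu, huy⟩ := exists_between hxy
  obtain ⟨v, huv, hvy⟩ := exists_between huy
  have hu : u ∈ Ioo a b := ⟨hx.1.trans_lt hxu, huy.trans_le hy.2⟩
  have hv : v ∈ Ioo a b := ⟨hu.1.trans huv, hvy.trans_le hy.2⟩
  have h1 : f x ≤ f u := by
    have := nhdsGT_neBot_of_exists_gt ⟨u, hxu⟩
    refine le_of_tendsto (hf.continuousWithinAt (s := Ioi x)) ?_
    filter_upwards [Ioo_mem_nhdsGT hxu] with w hw
    exact (h ⟨hx.1.trans_lt hw.1, hw.2.trans hu.2⟩ hu hw.2).le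
  have h2 : f v ≤ f y := by
    have := nhdsLT_neBot_of_exists_lt ⟨v, hvy⟩
    refine ge_of_tendsto (hf.continuousWithinAt (s := Iio y)) ?_
    filter_upwards [Ioo_mem_nhdsLT hvy] with w hw
    exact (h hv ⟨hv.1.trans hw.1, hw.2.trans_le hy.2⟩ hw.1).le
  exact h1.trans_lt ((h hu hv huv).trans_le h2)

lemma strictAntiOn_Icc_of_Ioo {f : unitInterval → unitInterval} (hf : Continuous f)
    {a b : unitInterval} (h : StrictAntiOn f (Ioo a b)) : StrictAntiOn f (Icc a b) := by
  have : StrictMonoOn (OrderDual.toDual ∘ f) (Icc a b) :=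
    strictMonoOn_Icc_of_Ioo (continuous_toDual.comp hf) h.dual_right
  exact this.dual_right

lemma mem_piece {i : Fin q} {y : τ.Space} : y ∈ τ.piece i ↔
    (τ.a i.castSucc < y.collapse ∨ τ.a i.castSucc = y.collapse ∧
      (y.flag = true ∨ y.collapse = 0)) ∧
    (y.collapse < τ.a i.succ ∨ y.collapse = τ.a i.succ ∧ y.flag = false) := by
  have h1 : τ.a i.castSucc ≠ 1 := ((τ.a_lt i).trans_le unitInterval.le_one').ne
  have h2 : τ.a i.castSucc = y.collapse → ((τ.a i.castSucc ∈ τ.generalizedOrbit \ {0, 1} →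
      y.flag = true) ↔ (y.flag = true ∨ y.collapse = 0)) := by
    intro h
    simp only [mem_sdiff, τ.a_mem, mem_insert_iff, h1, mem_singleton_iff, or_false, true_and, ← h]
    tauto
  rw [piece, mem_Icc, upper_le, le_lower]
  exact and_congr_left fun _ => or_congr_right (and_congr_right h2)

lemma isClopen_piece (i : Fin q) : IsClopen (τ.piece i) :=
  isClopen_Icc (τ.a_mem _) (τ.a_mem _) (τ.a_lt i)

lemma collapse_mem_Icc {i : Fin q} {y : τ.Space} (hy : y ∈ τ.piece i) :
    y.collapse ∈ Icc (τ.a i.castSucc) (τ.a i.succ) := by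
  rw [mem_piece] at hy
  exact ⟨hy.1.elim le_of_lt fun h => h.1.le, hy.2.elim le_of_lt fun h => h.1.le⟩

lemma pairwise_disjoint_piece : Pairwise (Disjoint on τ.piece) := by
  have key : ∀ i j, i < j → Disjoint (τ.piece i) (τ.piece j) := by
    intro i j hij
    rw [Set.disjoint_left]
    intro y hi hj
    have hle : τ.a i.succ ≤ τ.a j.castSucc := τ.a_strictMono.monotone (by
      rw [Fin.le_def]; simpa using hij)
    rw [mem_piece] at hi hj
    have hpos : 0 < τ.a i.succ := unitInterval.nonneg'.trans_lt (τ.a_lt i)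
    rcases hi.2 with h | ⟨h, hf⟩
    · rcases hj.1 with h' | ⟨h', -⟩
      · exact absurd (h.trans_le hle) h'.not_gt
      · exact absurd (h.trans_le hle) h'.not_gt
    · rcases hj.1 with h' | ⟨h', h''⟩
      · exact absurd (h.le.trans hle) h'.not_ge
      · rcases h'' with h'' | h''
        · simp [hf] at h''
        · exact absurd (h ▸ h'') hpos.ne'
  intro i j hij
  rcases hij.lt_or_gt with h | h
  · exact key i j h
  · exact (key j i h).symm

lemma iUnion_piece : ⋃ i, τ.piece i = univ := by
  refine eq_univ_of_forall fun y => ?_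
  rw [mem_iUnion]
  -- the first partition point that bounds `y` from above
  obtain ⟨k, hk, hmin⟩ := exists_minimal_of_wellFoundedLT (fun k => y ≤ lower _ (τ.a k))
    ⟨Fin.last q, by
      rw [le_lower, τ.a_last]
      rcases (unitInterval.le_one' : y.collapse ≤ 1).lt_or_eq with h | h
      · exact Or.inl h
      · refine Or.inr ⟨h, ?_⟩
        by_contra hf
        exact (mem_of_flag y (by simpa using hf)).2 (by simp [h])⟩
  rcases Fin.eq_zero_or_eq_succ k with rfl | ⟨i, rfl⟩
  · have h0 : y.collapse = 0 ∧ y.flag = false := by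
      rw [τ.a_zero, le_lower] at hk
      exact hk.resolve_left (not_lt.2 unitInterval.nonneg')
    cases q with
    | zero => exact absurd (τ.a_zero.symm.trans τ.a_last) (by simp)
    | succ n =>
      refine ⟨0, τ.mem_piece.2 ⟨Or.inr ⟨?_, Or.inr h0.1⟩, Or.inl ?_⟩⟩
      · rw [h0.1]; exact τ.a_zero
      · rw [h0.1, ← τ.a_zero]; exact τ.a_lt 0
  · refine ⟨i, ?_, hk⟩
    have hlt : ¬ y ≤ lower _ (τ.a i.castSucc) := fun h =>
      absurd (hmin h i.castSucc_lt_succ.le) (not_le.2 i.castSucc_lt_succ)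
    rw [le_lower, not_or, not_lt, not_and] at hlt
    rw [upper_le]
    rcases hlt.1.lt_or_eq with h | h
    · exact Or.inl h
    · exact Or.inr ⟨h, fun _ => by simpa using hlt.2 h.symm⟩

/-- A strictly monotone map between open order intervals is a homeomorphism. -/
lemma continuousOn_and_isOpen_image {α β : Type*} [LinearOrder α] [TopologicalSpace α]
    [OrderTopology α] [LinearOrder β] [TopologicalSpace β] [OrderTopology β] {f : α → β}
    {s : Set α} {t : Set β} [OrdConnected s] [ht' : OrdConnected t] (ht : IsOpen t)
    (hf : StrictMonoOn f s) (hst : f '' s = t) :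
    ContinuousOn f s ∧ ∀ U ⊆ s, IsOpen U → IsOpen (f '' U) := by
  subst hst
  let e := (hf.orderIso f s).toHomeomorph
  constructor
  · rw [continuousOn_iff_continuous_domRestrict]
    exact continuous_subtype_val.comp e.continuous
  · intro U hU hUo
    have : f '' U = Subtype.val '' (e '' (Subtype.val ⁻¹' U)) := by
      ext z
      constructor
      · rintro ⟨y, hy, rfl⟩
        exact ⟨_, ⟨⟨y, hU hy⟩, hy, rfl⟩, rfl⟩
      · rintro ⟨_, ⟨⟨y, hy'⟩, hy, rfl⟩, rfl⟩
        exact ⟨y, hy, rfl⟩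
    rw [this]
    exact ht.isOpenMap_subtype_val _ (e.isOpenMap _ (hUo.preimage continuous_subtype_val))

open Classical in
lemma localHomeo_of_mono {i : Fin q} {y : τ.Space} (hy : y ∈ τ.piece i)
    (h : StrictMonoOn τ.toFun (Ioo (τ.a i.castSucc) (τ.a i.succ))) :
    τ.localHomeo y = if y.flag = true ∨ y.collapse = 0
      then upper _ (τ.toFun y.collapse) else lower _ (τ.toFun y.collapse) := by
  unfold localHomeo
  have : ∃ i, y ∈ τ.piece i ∧ StrictMonoOn τ.toFun (Ioo (τ.a i.castSucc) (τ.a i.succ)) :=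
    ⟨i, hy, h⟩
  simp only [this, true_iff]

open Classical in
lemma localHomeo_of_anti {i : Fin q} {y : τ.Space} (hy : y ∈ τ.piece i)
    (h : StrictAntiOn τ.toFun (Ioo (τ.a i.castSucc) (τ.a i.succ))) :
    τ.localHomeo y = if y.flag = true ∨ y.collapse = 0
      then lower _ (τ.toFun y.collapse) else upper _ (τ.toFun y.collapse) := by
  unfold localHomeo
  have : ¬ ∃ i, y ∈ τ.piece i ∧ StrictMonoOn τ.toFun (Ioo (τ.a i.castSucc) (τ.a i.succ)) := by
    rintro ⟨j, hj, hm⟩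
    have hij : j = i := by
      by_contra hne
      exact Set.disjoint_left.1 (τ.pairwise_disjoint_piece hne) hj hy
    subst hij
    obtain ⟨u, hu1, hu2⟩ := exists_between (τ.a_lt j)
    obtain ⟨v, hv1, hv2⟩ := exists_between hu2
    exact (hm ⟨hu1, hu2⟩ ⟨hu1.trans hv1, hv2⟩ hv1).not_gt
      (h ⟨hu1, hu2⟩ ⟨hu1.trans hv1, hv2⟩ hv1)
  simp only [this, false_iff]
  split_ifs <;> rfl

/-- Two different points of a piece with the same collapse `x` are `x⁻ < x⁺`, and `x` is interior
to the interval of monotonicity. -/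
lemma of_lt_of_collapse_eq {i : Fin q} {y z : τ.Space} (hy : y ∈ τ.piece i) (hz : z ∈ τ.piece i)
    (hyz : y < z) (h : y.collapse = z.collapse) : y.flag = false ∧ z.flag = true ∧
      y.collapse ≠ 0 ∧ y.collapse ∈ τ.generalizedOrbit ∧
      τ.a i.castSucc < y.collapse ∧ y.collapse < τ.a i.succ := by
  obtain ⟨-, hf, hg⟩ := (lt_iff'.1 hyz).resolve_left (by rw [h]; exact lt_irrefl _)
  have hm := mem_of_flag z hg
  rw [← h] at hm
  have h0 : y.collapse ≠ 0 := fun h' => hm.2 (by simp [h'])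
  refine ⟨hf, hg, h0, hm.1, (τ.mem_piece.1 hy).1.resolve_right ?_,
    h ▸ (τ.mem_piece.1 hz).2.resolve_right ?_⟩
  · rintro ⟨-, h' | h'⟩
    · simp [hf] at h'
    · exact h0 h'
  · rintro ⟨-, h'⟩
    simp [hg] at h'

lemma lower_lt_upper {D : Set unitInterval} {x u v : unitInterval} (hx : x ∈ D) (hu : u < x)
    (hv : x < v) : lower D x < upper D x := by
  have h : x ∈ D \ {0, 1} := ⟨hx, by
    simp [(unitInterval.nonneg'.trans_lt hu).ne', (hv.trans_le unitInterval.le_one').ne]⟩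
  exact lt_iff'.2 (Or.inr ⟨rfl, rfl, by simp only [flag_upper, h, decide_true]⟩)

lemma localHomeo_lt {y z : τ.Space} (h : τ.toFun y.collapse < τ.toFun z.collapse) :
    τ.localHomeo y < τ.localHomeo z :=
  lt_iff'.2 (Or.inl (by rwa [collapse_localHomeo, collapse_localHomeo]))

lemma strictMonoOn_localHomeo {i : Fin q}
    (h : StrictMonoOn τ.toFun (Ioo (τ.a i.castSucc) (τ.a i.succ))) :
    StrictMonoOn τ.localHomeo (τ.piece i) := by
  have hI := strictMonoOn_Icc_of_Ioo τ.continuous_toFun h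
  intro y hy z hz hyz
  have hyI := τ.collapse_mem_Icc hy
  have hzI := τ.collapse_mem_Icc hz
  rcases lt_iff'.1 hyz with hlt | ⟨heq, -⟩
  · exact τ.localHomeo_lt (hI hyI hzI hlt)
  · obtain ⟨hf, hg, h0, hm, hl, hr⟩ := τ.of_lt_of_collapse_eq hy hz hyz heq
    rw [τ.localHomeo_of_mono hy h, τ.localHomeo_of_mono hz h, if_neg (by simp [hf, h0]),
      if_pos (Or.inl hg), ← heq]
    exact lower_lt_upper (τ.map_mem hm) (hI (left_mem_Icc.2 (τ.a_lt i).le) hyI hl)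
      (hI hyI (right_mem_Icc.2 (τ.a_lt i).le) hr)

lemma strictAntiOn_localHomeo {i : Fin q}
    (h : StrictAntiOn τ.toFun (Ioo (τ.a i.castSucc) (τ.a i.succ))) :
    StrictAntiOn τ.localHomeo (τ.piece i) := by
  have hI := strictAntiOn_Icc_of_Ioo τ.continuous_toFun h
  intro y hy z hz hyz
  have hyI := τ.collapse_mem_Icc hy
  have hzI := τ.collapse_mem_Icc hz
  rcases lt_iff'.1 hyz with hlt | ⟨heq, -⟩
  · exact τ.localHomeo_lt (hI hyI hzI hlt)
  · obtain ⟨hf, hg, h0, hm, hl, hr⟩ := τ.of_lt_of_collapse_eq hy hz hyz heq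
    rw [τ.localHomeo_of_anti hy h, τ.localHomeo_of_anti hz h, if_pos (Or.inl hg),
      if_neg (by simp [hf, h0]), ← heq]
    exact lower_lt_upper (τ.map_mem hm) (hI hyI (right_mem_Icc.2 (τ.a_lt i).le) hr)
      (hI (left_mem_Icc.2 (τ.a_lt i).le) hyI hl)

lemma upper_mem_piece (i : Fin q) : upper _ (τ.a i.castSucc) ∈ τ.piece i :=
  left_mem_Icc.2 (le_lower.2 (Or.inl (τ.a_lt i)))

lemma lower_mem_piece (i : Fin q) : lower _ (τ.a i.succ) ∈ τ.piece i :=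
  right_mem_Icc.2 (le_lower.2 (Or.inl (τ.a_lt i)))

lemma right_upper (i : Fin q) :
    (upper τ.generalizedOrbit (τ.a i.castSucc)).flag = true ∨
      (upper τ.generalizedOrbit (τ.a i.castSucc)).collapse = 0 := by
  rcases (τ.mem_piece.1 (τ.upper_mem_piece i)).1 with h | h
  · exact absurd h (lt_irrefl _)
  · exact h.2

lemma not_right_lower (i : Fin q) :
    ¬ ((lower τ.generalizedOrbit (τ.a i.succ)).flag = true ∨
      (lower τ.generalizedOrbit (τ.a i.succ)).collapse = 0) := by
  simp [(unitInterval.nonneg'.trans_lt (τ.a_lt i)).ne']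

/-- A point of the generalized orbit, other than the right end of an interval of monotonicity, has
a right point over it in the corresponding piece. -/
lemma exists_right {i : Fin q} {x : unitInterval} (hx : x ∈ Icc (τ.a i.castSucc) (τ.a i.succ))
    (hx' : x < τ.a i.succ) (hD : x ∈ τ.generalizedOrbit) :
    ∃ y ∈ τ.piece i, y.collapse = x ∧ (y.flag = true ∨ y.collapse = 0) := by
  have hr : (upper τ.generalizedOrbit x).flag = true ∨
      (upper τ.generalizedOrbit x).collapse = 0 := by
    by_cases h0 : x = 0
    · exact Or.inr h0
    · left
      have : x ∈ τ.generalizedOrbit \ {0, 1} :=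
        ⟨hD, by simp [h0, (hx'.trans_le unitInterval.le_one').ne]⟩
      simp only [flag_upper, this, decide_true]
  exact ⟨upper _ x, τ.mem_piece.2 ⟨hx.1.lt_or_eq.imp id fun h => ⟨h, hr⟩, Or.inl hx'⟩, rfl, hr⟩

lemma exists_left {i : Fin q} {x : unitInterval} (hx : x ∈ Icc (τ.a i.castSucc) (τ.a i.succ))
    (hx' : τ.a i.castSucc < x) :
    ∃ y ∈ τ.piece i, y.collapse = x ∧ ¬ (y.flag = true ∨ y.collapse = 0) :=
  ⟨lower _ x, τ.mem_piece.2 ⟨Or.inl hx', hx.2.lt_or_eq.imp id fun h => ⟨h, rfl⟩⟩, rfl, by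
    simp [(unitInterval.nonneg'.trans_lt hx').ne']⟩

lemma eq_upper_of_flag {D : Set unitInterval} {w : Disconnection D} (h : w.flag = true) :
    upper D w.collapse = w :=
  ext' rfl (by simp only [flag_upper, mem_of_flag w h, decide_true, h])

lemma eq_lower_of_flag {D : Set unitInterval} {w : Disconnection D} (h : w.flag = false) :
    lower D w.collapse = w :=
  ext' rfl (by rw [flag_lower, h])

lemma image_piece_of_mono {i : Fin q}
    (h : StrictMonoOn τ.toFun (Ioo (τ.a i.castSucc) (τ.a i.succ))) :
    τ.localHomeo '' τ.piece i =
      Icc (upper _ (τ.toFun (τ.a i.castSucc))) (lower _ (τ.toFun (τ.a i.succ))) := by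
  have hm := (τ.strictMonoOn_localHomeo h).monotoneOn
  have hU := τ.localHomeo_of_mono (τ.upper_mem_piece i) h
  have hL := τ.localHomeo_of_mono (τ.lower_mem_piece i) h
  rw [if_pos (τ.right_upper i)] at hU
  rw [if_neg (τ.not_right_lower i)] at hL
  refine Subset.antisymm ?_ ?_
  · rintro _ ⟨y, hy, rfl⟩
    exact ⟨hU.symm.le.trans (hm (τ.upper_mem_piece i) hy hy.1),
      (hm hy (τ.lower_mem_piece i) hy.2).trans hL.le⟩
  · rintro w ⟨h1, h2⟩
    rw [upper_le] at h1
    rw [le_lower] at h2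
    obtain ⟨x, hx, hxw⟩ := intermediate_value_Icc (τ.a_lt i).le τ.continuous_toFun.continuousOn
      (show w.collapse ∈ Icc _ _ from ⟨h1.elim le_of_lt fun h => h.1.le,
        h2.elim le_of_lt fun h => h.1.le⟩)
    cases hf : w.flag with
    | true =>
      have hne : x ≠ τ.a i.succ := by
        rintro rfl
        rcases h2 with h2 | h2
        · exact h2.ne hxw.symm
        · simp [hf] at h2
      obtain ⟨y, hy, rfl, hr⟩ := τ.exists_right hx (hx.2.lt_of_ne hne)
        (τ.mem_of_map_mem (hxw ▸ (mem_of_flag w hf).1))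
      refine ⟨y, hy, ?_⟩
      rw [τ.localHomeo_of_mono hy h, if_pos hr, hxw, eq_upper_of_flag hf]
    | false =>
      rcases hx.1.lt_or_eq with hlt | rfl
      · obtain ⟨y, hy, rfl, hr⟩ := τ.exists_left hx hlt
        refine ⟨y, hy, ?_⟩
        rw [τ.localHomeo_of_mono hy h, if_neg hr, hxw, eq_lower_of_flag hf]
      · refine ⟨_, τ.upper_mem_piece i, ?_⟩
        rw [hU, collapse_upper, ← lower_eq_upper, hxw, eq_lower_of_flag hf]
        intro hD
        rcases h1 with h1 | h1
        · exact h1.ne hxw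
        · exact absurd (hf.symm.trans (h1.2 hD)) Bool.false_ne_true

lemma image_piece_of_anti {i : Fin q}
    (h : StrictAntiOn τ.toFun (Ioo (τ.a i.castSucc) (τ.a i.succ))) :
    τ.localHomeo '' τ.piece i =
      Icc (upper _ (τ.toFun (τ.a i.succ))) (lower _ (τ.toFun (τ.a i.castSucc))) := by
  have hm := (τ.strictAntiOn_localHomeo h).antitoneOn
  have hU := τ.localHomeo_of_anti (τ.upper_mem_piece i) h
  have hL := τ.localHomeo_of_anti (τ.lower_mem_piece i) h
  rw [if_pos (τ.right_upper i)] at hU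
  rw [if_neg (τ.not_right_lower i)] at hL
  refine Subset.antisymm ?_ ?_
  · rintro _ ⟨y, hy, rfl⟩
    exact ⟨hL.symm.le.trans (hm hy (τ.lower_mem_piece i) hy.2),
      (hm (τ.upper_mem_piece i) hy hy.1).trans hU.le⟩
  · rintro w ⟨h1, h2⟩
    rw [upper_le] at h1
    rw [le_lower] at h2
    obtain ⟨x, hx, hxw⟩ := intermediate_value_Icc' (τ.a_lt i).le τ.continuous_toFun.continuousOn
      (show w.collapse ∈ Icc _ _ from ⟨h1.elim le_of_lt fun h => h.1.le,
        h2.elim le_of_lt fun h => h.1.le⟩)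
    cases hf : w.flag with
    | true =>
      have hne : τ.a i.castSucc ≠ x := by
        rintro rfl
        rcases h2 with h2 | h2
        · exact h2.ne hxw.symm
        · simp [hf] at h2
      obtain ⟨y, hy, rfl, hr⟩ := τ.exists_left hx (hx.1.lt_of_ne hne)
      refine ⟨y, hy, ?_⟩
      rw [τ.localHomeo_of_anti hy h, if_neg hr, hxw, eq_upper_of_flag hf]
    | false =>
      rcases hx.2.lt_or_eq with hlt | rfl
      · by_cases hD : x ∈ τ.generalizedOrbit
        · obtain ⟨y, hy, rfl, hr⟩ := τ.exists_right hx hlt hD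
          refine ⟨y, hy, ?_⟩
          rw [τ.localHomeo_of_anti hy h, if_pos hr, hxw, eq_lower_of_flag hf]
        · have hlt' : τ.a i.castSucc < x := hx.1.lt_of_ne fun h' => hD (h' ▸ τ.a_mem _)
          obtain ⟨y, hy, rfl, hr⟩ := τ.exists_left hx hlt'
          refine ⟨y, hy, ?_⟩
          rw [τ.localHomeo_of_anti hy h, if_neg hr, ← lower_eq_upper, hxw, eq_lower_of_flag hf]
          exact fun h' => hD (τ.mem_of_map_mem h'.1)
      · refine ⟨_, τ.lower_mem_piece i, ?_⟩
        rw [hL, collapse_lower, ← lower_eq_upper, hxw, eq_lower_of_flag hf]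
        intro hD
        rcases h1 with h1 | h1
        · exact h1.ne hxw
        · exact absurd (hf.symm.trans (h1.2 hD)) Bool.false_ne_true

/-- On each piece, `σ` is a homeomorphism onto a clopen order interval. -/
lemma localHomeo_piece (i : Fin q) :
    InjOn τ.localHomeo (τ.piece i) ∧ IsClosed (τ.localHomeo '' τ.piece i) ∧
    ContinuousOn τ.localHomeo (τ.piece i) ∧
    ∀ U ⊆ τ.piece i, IsOpen U → IsOpen (τ.localHomeo '' U) := by
  have : OrdConnected (τ.piece i) := ordConnected_Icc
  have hl : τ.a i.castSucc ∈ Icc (τ.a i.castSucc) (τ.a i.succ) := left_mem_Icc.2 (τ.a_lt i).le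
  have hr : τ.a i.succ ∈ Icc (τ.a i.castSucc) (τ.a i.succ) := right_mem_Icc.2 (τ.a_lt i).le
  rcases τ.monotonic i with h | h
  · have hs := τ.strictMonoOn_localHomeo h
    have himg := τ.image_piece_of_mono h
    have hc := isClopen_Icc (τ.map_mem (τ.a_mem i.castSucc)) (τ.map_mem (τ.a_mem i.succ))
      (strictMonoOn_Icc_of_Ioo τ.continuous_toFun h hl hr (τ.a_lt i))
    exact ⟨hs.injOn, himg ▸ hc.1, continuousOn_and_isOpen_image hc.2 hs himg⟩
  · have hs := τ.strictAntiOn_localHomeo h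
    have himg := τ.image_piece_of_anti h
    have hc := isClopen_Icc (τ.map_mem (τ.a_mem i.succ)) (τ.map_mem (τ.a_mem i.castSucc))
      (strictAntiOn_Icc_of_Ioo τ.continuous_toFun h hl hr (τ.a_lt i))
    have hdual := continuousOn_and_isOpen_image (f := OrderDual.toDual ∘ τ.localHomeo)
      (t := OrderDual.ofDual ⁻¹' Icc (upper _ (τ.toFun (τ.a i.succ)))
        (lower _ (τ.toFun (τ.a i.castSucc)))) (ht' := ordConnected_Icc.dual)
      (hc.2.preimage continuous_ofDual) hs.dual_right (by
        rw [← himg, image_comp]; exact OrderDual.toDual.image_eq_preimage_symm _)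
    refine ⟨hs.injOn, himg ▸ hc.1, hdual.1, fun U hU hUo => ?_⟩
    have := (hdual.2 U hU hUo).preimage continuous_toDual
    rwa [image_comp, preimage_image_eq _ OrderDual.toDual.injective] at this

theorem isPiecewiseHomeo_localHomeo : IsPiecewiseHomeo τ.localHomeo where
  continuous := by
    rw [continuous_iff_continuousAt]
    intro y
    obtain ⟨i, hi⟩ := mem_iUnion.1 (τ.iUnion_piece.symm ▸ mem_univ y : y ∈ ⋃ i, τ.piece i)
    exact (τ.localHomeo_piece i).2.2.1.continuousAt ((τ.isClopen_piece i).2.mem_nhds hi)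
  isOpenMap := by
    intro U hU
    have : τ.localHomeo '' U = ⋃ i, τ.localHomeo '' (U ∩ τ.piece i) := by
      rw [← image_iUnion, ← inter_iUnion, τ.iUnion_piece, inter_univ]
    rw [this]
    exact isOpen_iUnion fun i => (τ.localHomeo_piece i).2.2.2 _ inter_subset_right
      (hU.inter (τ.isClopen_piece i).2)
  exists_partition := ⟨q, τ.piece, τ.isClopen_piece, τ.pairwise_disjoint_piece, τ.iUnion_piece,
    fun i => ⟨(τ.localHomeo_piece i).1, (τ.localHomeo_piece i).2.1⟩⟩

/-- If `τ` is surjective, then so is `σ`. -/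
theorem localHomeo_surjective (hs : Surjective τ.toFun) : Surjective τ.localHomeo := by
  intro w
  -- it suffices to catch `w` between the images of the endpoints of a piece
  have key : ∀ i : Fin q, (upper _ (τ.toFun (τ.a i.castSucc)) ≤ w ∧
      w ≤ lower _ (τ.toFun (τ.a i.succ)) ∨ upper _ (τ.toFun (τ.a i.succ)) ≤ w ∧
      w ≤ lower _ (τ.toFun (τ.a i.castSucc))) → ∃ y, τ.localHomeo y = w := by
    intro i hi
    have hlt : ∀ {u v : unitInterval}, upper τ.generalizedOrbit u ≤ w →
        w ≤ lower τ.generalizedOrbit v → u ≤ v := fun h1 h2 =>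
      ((upper_le.1 h1).elim le_of_lt fun h => h.1.le).trans
        ((le_lower.1 h2).elim le_of_lt fun h => h.1.le)
    have hl : τ.a i.castSucc ∈ Icc (τ.a i.castSucc) (τ.a i.succ) := left_mem_Icc.2 (τ.a_lt i).le
    have hr : τ.a i.succ ∈ Icc (τ.a i.castSucc) (τ.a i.succ) := right_mem_Icc.2 (τ.a_lt i).le
    rcases τ.monotonic i with h | h
    · have hI := strictMonoOn_Icc_of_Ioo τ.continuous_toFun h hl hr (τ.a_lt i)
      have hi' := hi.resolve_right fun h' => (hlt h'.1 h'.2).not_gt hI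
      obtain ⟨y, -, hy⟩ : w ∈ τ.localHomeo '' τ.piece i := τ.image_piece_of_mono h ▸ hi'
      exact ⟨y, hy⟩
    · have hI := strictAntiOn_Icc_of_Ioo τ.continuous_toFun h hl hr (τ.a_lt i)
      have hi' := hi.resolve_left fun h' => (hlt h'.1 h'.2).not_gt hI
      obtain ⟨y, -, hy⟩ : w ∈ τ.localHomeo '' τ.piece i := τ.image_piece_of_anti h ▸ hi'
      exact ⟨y, hy⟩
  -- every value lies between the values at the endpoints of some piece
  have hval : ∀ v, ∃ i : Fin q, (τ.toFun (τ.a i.castSucc) ≤ v ∧ v ≤ τ.toFun (τ.a i.succ)) ∨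
      (τ.toFun (τ.a i.succ) ≤ v ∧ v ≤ τ.toFun (τ.a i.castSucc)) := by
    intro v
    obtain ⟨x, rfl⟩ := hs v
    obtain ⟨i, hi⟩ := mem_iUnion.1 (τ.iUnion_piece.symm ▸ mem_univ (lower _ x) :
      lower _ x ∈ ⋃ i, τ.piece i)
    have hx : x ∈ Icc (τ.a i.castSucc) (τ.a i.succ) := τ.collapse_mem_Icc hi
    have hl : τ.a i.castSucc ∈ Icc (τ.a i.castSucc) (τ.a i.succ) := left_mem_Icc.2 (τ.a_lt i).le
    have hr : τ.a i.succ ∈ Icc (τ.a i.castSucc) (τ.a i.succ) := right_mem_Icc.2 (τ.a_lt i).le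
    refine ⟨i, ?_⟩
    rcases τ.monotonic i with h | h
    · have hI := (strictMonoOn_Icc_of_Ioo τ.continuous_toFun h).monotoneOn
      exact Or.inl ⟨hI hl hx hx.1, hI hx hr hx.2⟩
    · have hI := (strictAntiOn_Icc_of_Ioo τ.continuous_toFun h).antitoneOn
      exact Or.inr ⟨hI hx hr hx.2, hI hl hx hx.1⟩
  by_cases hw : w.flag = true ∨ w.collapse = 0
  · have h1 : w.collapse < 1 := by
      rcases hw with hw | hw
      · refine unitInterval.le_one'.lt_of_ne fun h => (mem_of_flag w hw).2 (by simp [h])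
      · rw [hw]; exact zero_lt_one
    have := nhdsGT_neBot_of_exists_gt ⟨1, h1⟩
    have hev : ∀ᶠ v in 𝓝[>] w.collapse, w.collapse < v ∧
        ∀ k, τ.toFun (τ.a k) ≤ v → τ.toFun (τ.a k) ≤ w.collapse := by
      refine (eventually_mem_nhdsWithin).and (Filter.eventually_all.2 fun k => ?_)
      by_cases hk : τ.toFun (τ.a k) ≤ w.collapse
      · exact Filter.Eventually.of_forall fun _ _ => hk
      · filter_upwards [Ioo_mem_nhdsGT (not_le.1 hk)] with v hv h
        exact absurd h hv.2.not_ge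
    obtain ⟨v, hv, hk⟩ := hev.exists
    have hup : ∀ k, τ.toFun (τ.a k) ≤ v → upper _ (τ.toFun (τ.a k)) ≤ w := by
      intro k h
      rw [upper_le]
      refine (hk k h).lt_or_eq.imp id fun h' => ⟨h', fun hD => hw.resolve_right fun h0 => ?_⟩
      exact hD.2 (by rw [h', h0]; simp)
    have hlo : ∀ k, v ≤ τ.toFun (τ.a k) → w ≤ lower _ (τ.toFun (τ.a k)) :=
      fun k h => le_lower.2 (Or.inl (hv.trans_le h))
    obtain ⟨i, hi⟩ := hval v
    exact key i (hi.imp (fun h => ⟨hup _ h.1, hlo _ h.2⟩) fun h => ⟨hup _ h.1, hlo _ h.2⟩)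
  · rw [not_or, Bool.not_eq_true] at hw
    have h0 : 0 < w.collapse := unitInterval.nonneg'.lt_of_ne (Ne.symm hw.2)
    have := nhdsLT_neBot_of_exists_lt ⟨0, h0⟩
    have hev : ∀ᶠ v in 𝓝[<] w.collapse, v < w.collapse ∧
        ∀ k, v ≤ τ.toFun (τ.a k) → w.collapse ≤ τ.toFun (τ.a k) := by
      refine (eventually_mem_nhdsWithin).and (Filter.eventually_all.2 fun k => ?_)
      by_cases hk : w.collapse ≤ τ.toFun (τ.a k)
      · exact Filter.Eventually.of_forall fun _ _ => hk
      · filter_upwards [Ioo_mem_nhdsLT (not_le.1 hk)] with v hv h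
        exact absurd h hv.1.not_ge
    obtain ⟨v, hv, hk⟩ := hev.exists
    have hup : ∀ k, τ.toFun (τ.a k) ≤ v → upper _ (τ.toFun (τ.a k)) ≤ w :=
      fun k h => upper_le.2 (Or.inl (h.trans_lt hv))
    have hlo : ∀ k, v ≤ τ.toFun (τ.a k) → w ≤ lower _ (τ.toFun (τ.a k)) :=
      fun k h => le_lower.2 ((hk k h).lt_or_eq.imp id fun h' => ⟨h', hw.1⟩)
    obtain ⟨i, hi⟩ := hval v
    exact key i (hi.imp (fun h => ⟨hup _ h.1, hlo _ h.2⟩) fun h => ⟨hup _ h.1, hlo _ h.2⟩)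

/-- The dimension group `DG(τ) = G_σ`, where `σ` is the local homeomorphism associated with `τ` and
its partition. -/
abbrev DG : Type := τ.isPiecewiseHomeo_localHomeo.DimensionGroup

/-- The dimension module of a surjective `τ`: the group `DG(τ)` as a `ℤ[t,t⁻¹]`-module, with `t`
acting as `L_*`. -/
@[reducible] def dgModule (hs : Surjective τ.toFun) : Module ℤ[T;T⁻¹] τ.DG :=
  τ.isPiecewiseHomeo_localHomeo.dimensionModule (τ.localHomeo_surjective hs)

/-- The element `I(c, d)` of `DG(τ)`, for points `c < d` of the generalized orbit: the class of the
characteristic function of the order interval `[c⁺, d⁻]` of `X`. -/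
def intervalClass {c d : unitInterval} (hc : c ∈ τ.generalizedOrbit)
    (hd : d ∈ τ.generalizedOrbit) (h : c < d) : τ.DG :=
  τ.isPiecewiseHomeo_localHomeo.cls (intervalChar hc hd h)

end MultimodalMap

end

/-! Write e_c for the characteristic function of [0, c⁻], with e_0 = 0. A continuous function X → ℤ
has finitely many jumps f(x⁺) - f(x⁻), all at points of I₁, and is determined by them and its value
at 1. Hence the e_c with 0 ≠ c ∈ I₁ form a ℤ-basis of C(X, ℤ) (`stepHom_initialChar`,
`map_eq_stepHom`). If c and d lie in the same lap [a_{i-1}, a_i], then 𝓛(e_d - e_c) = ε_i (e_{τ(d)}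
- e_{τ(c)}), where ε_i = ±1 is the sign of τ there (`transfer_initial_sub`). So an additive map ψ
into a ℤ[t,t⁻¹]-module with ψ𝓛 = tψ is the same as a function v on I₁ with v(0) = 0 and t(v(d) -
v(c)) = ε_i (v(τ(d)) - v(τ(c))) on each lap.

Neither endpoint is the image of an endpoint, so surjectivity gives inner partition points with
τ(a_{i₀}) = 0 and τ(a_{j₀}) = 1. These two points drive both halves of the proof.

Independence: v may be prescribed freely at a_1, …, a_{q-1} (`exists_equivariant_values`). The
relations fix the differences of the values at the τ(a_k), the condition v(τ(a_{i₀})) = 0 fixes the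
values themselves, and v(1) = v(τ(a_{j₀})) is then forced. On each lap the relation reads v(τ(c)) =
A_i(v(c)) for an affine bijection A_i. The inner orbits are infinite and disjoint, so v can be
propagated along them without conflict, and then pulled back along preimages to all of I₁. Taking
v(a_k) to be the sum of the first k standard vectors of ℤ[t,t⁻¹]^{q-1} gives a map ψ. It kills the
eventual kernel because t is invertible, so it descends to DG(τ), where it sends the proposed basis
to the standard one.

Spanning: the same relations, read modulo a submodule containing [e_{a_k}] for k < q, put every
[e_c] into it (`map_mem_of_initial_mem`). -/

noncomputable section

/-! ### Jumps of continuous integer valued functions -/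

namespace Disconnection

variable {D : Set unitInterval}

lemma eq_lower_or_eq_upper (y : Disconnection D) :
    y = lower D y.collapse ∨ y = upper D y.collapse := by
  cases h : y.flag with
  | true => exact Or.inr (MultimodalMap.eq_upper_of_flag h).symm
  | false => exact Or.inl (MultimodalMap.eq_lower_of_flag h).symm

/-- Near `x`, a continuous integer valued function has only one value on each side of `x`. -/
lemma exists_nhds_forall_eq (f : C(Disconnection D, ℤ)) (x : unitInterval) :
    ∃ U ∈ 𝓝 x, ∀ y : Disconnection D, y.collapse ∈ U →
      (y.collapse < x → f y = f (lower D x)) ∧ (x < y.collapse → f y = f (upper D x)) := by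
  have hn : ∀ w, {y | f y = f w} ∈ 𝓝 w := fun w =>
    ((isOpen_discrete {f w}).preimage f.continuous).mem_nhds rfl
  have hl : ∃ U ∈ 𝓝 x, ∀ y : Disconnection D, y.collapse ∈ U →
      (y.collapse < x → f y = f (lower D x)) := by
    -- If x⁻ is the least point of X, nothing lies to the left of x and the claim is vacuous.
    by_cases h0 : ∃ l, l < lower D x
    · obtain ⟨l, hl, hs⟩ := exists_Ioc_subset_of_mem_nhds (hn (lower D x)) h0
      have hlx : l.collapse < x := by
        rcases lt_iff'.1 hl with h | h
        · exact h
        · simp at h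
      exact ⟨Ioi l.collapse, Ioi_mem_nhds hlx, fun y hy hyx =>
        hs ⟨lt_iff'.2 (Or.inl hy), le_lower.2 (Or.inl hyx)⟩⟩
    · exact ⟨univ, Filter.univ_mem, fun y _ hyx =>
        absurd ⟨y, lt_iff'.2 (Or.inl hyx)⟩ h0⟩
  have hr : ∃ U ∈ 𝓝 x, ∀ y : Disconnection D, y.collapse ∈ U →
      (x < y.collapse → f y = f (upper D x)) := by
    by_cases h0 : ∃ u, upper D x < u
    · obtain ⟨u, hu, hs⟩ := exists_Ico_subset_of_mem_nhds (hn (upper D x)) h0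
      have hux : x < u.collapse := by
        rcases lt_iff'.1 hu with h | ⟨h1, h2, h3⟩
        · exact h
        · have := mem_of_flag u h3
          rw [← h1, collapse_upper] at this
          simp only [flag_upper, this, decide_true] at h2
          exact absurd h2 (by simp)
      exact ⟨Iio u.collapse, Iio_mem_nhds hux, fun y hy hyx =>
        hs ⟨upper_le.2 (Or.inl hyx), lt_iff'.2 (Or.inl hy)⟩⟩
    · exact ⟨univ, Filter.univ_mem, fun y _ hyx =>
        absurd ⟨y, lt_iff'.2 (Or.inl hyx)⟩ h0⟩
  obtain ⟨U, hU, hU'⟩ := hl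
  obtain ⟨W, hW, hW'⟩ := hr
  exact ⟨U ∩ W, Filter.inter_mem hU hW, fun y hy => ⟨hU' y hy.1, hW' y hy.2⟩⟩

/-- By compactness, [0,1] is covered by finitely many neighbourhoods from `exists_nhds_forall_eq`,
and inside each of these a jump can occur only at the centre. -/
lemma finite_support_jump (f : C(Disconnection D, ℤ)) :
    (support fun x => f (upper D x) - f (lower D x)).Finite := by
  choose U hU hU' using exists_nhds_forall_eq f
  obtain ⟨t, -, ht⟩ := isCompact_univ.elim_nhds_subcover U fun x _ => hU x
  refine t.finite_toSet.subset fun y hy => ?_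
  by_contra hyt
  obtain ⟨x, hx, hyx⟩ := mem_iUnion₂.1 (ht (mem_univ y))
  have hne : y ≠ x := fun h => hyt (h ▸ hx)
  refine hy (sub_eq_zero.2 ?_)
  rcases hne.lt_or_gt with h | h
  · rw [(hU' x (upper D y) hyx).1 h, (hU' x (lower D y) hyx).1 h]
  · rw [(hU' x (upper D y) hyx).2 h, (hU' x (lower D y) hyx).2 h]

/-- The jumps `f(x⁺) - f(x⁻)` of a continuous integer valued function. -/
def jump : C(Disconnection D, ℤ) →+ (unitInterval →₀ ℤ) where
  toFun f := Finsupp.ofSupportFinite (fun x => f (upper D x) - f (lower D x))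
    (finite_support_jump f)
  map_zero' := by ext x; simp [Finsupp.ofSupportFinite]
  map_add' f g := by
    ext x
    exact add_sub_add_comm _ _ _ _

lemma jump_apply (f : C(Disconnection D, ℤ)) (x : unitInterval) :
    jump f x = f (upper D x) - f (lower D x) := rfl

/-- Without jumps, x ↦ f(x⁻) is locally constant on the connected space [0,1], so its value at 1 is
its only value. -/
lemma eq_zero_of_jump_eq_zero {f : C(Disconnection D, ℤ)} (h : jump f = 0)
    (h1 : f (lower D 1) = 0) : f = 0 := by
  have hj : ∀ x, f (upper D x) = f (lower D x) := fun x =>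
    sub_eq_zero.1 (DFunLike.congr_fun h x)
  have hloc : IsLocallyConstant fun x => f (lower D x) := by
    rw [IsLocallyConstant.iff_eventually_eq]
    intro x
    obtain ⟨U, hU, hU'⟩ := exists_nhds_forall_eq f x
    filter_upwards [hU] with y hy
    rcases lt_trichotomy y x with hyx | rfl | hyx
    · exact (hU' (lower D y) hy).1 hyx
    · rfl
    · exact ((hU' (lower D y) hy).2 hyx).trans (hj x)
  have hz : ∀ x, f (lower D x) = 0 := fun x =>
    (hloc.apply_eq_of_preconnectedSpace x 1).trans h1
  ext y
  rcases eq_lower_or_eq_upper y with hy | hy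
  · rw [hy]; exact hz _
  · rw [hy, hj]; exact hz _

/-! ### The functions e_c as a basis of C(X, ℤ) -/

open Classical in
/-- The characteristic function of the order interval `[0, c⁻]`, for `c ∈ D \ {0}`, and zero
for any other `c`. -/
def initialChar (h0 : (0 : unitInterval) ∈ D) (c : unitInterval) : C(Disconnection D, ℤ) :=
  if h : c ∈ D ∧ 0 < c then intervalChar h0 h.1 h.2 else 0

variable {h0 : (0 : unitInterval) ∈ D}

open Classical in
lemma initialChar_apply {c : unitInterval} (hc : c ∈ D) (hpos : 0 < c) (y : Disconnection D) :
    initialChar h0 c y = if y ≤ lower D c then 1 else 0 := by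
  have h : upper D 0 ≤ y := by
    rw [upper_le]
    rcases (unitInterval.nonneg' : 0 ≤ y.collapse).lt_or_eq with h | h
    · exact Or.inl h
    · exact Or.inr ⟨h, fun h' => absurd h'.2 (by simp)⟩
  rw [initialChar, dif_pos ⟨hc, hpos⟩]
  simp [intervalChar, indicator_apply, h]

@[simp] lemma initialChar_zero : initialChar h0 0 = 0 := dif_neg fun h => lt_irrefl _ h.2

/-- For c > 0 the point c is doubled and nothing lies between c⁻ and c⁺, so the conditions c⁺ ≤ y
and y ≤ c⁻ are complementary. For c = 0 the subtracted term is zero by convention. -/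
lemma intervalChar_eq_sub {c d : unitInterval} (hc : c ∈ D) (hd : d ∈ D) (h : c < d) :
    intervalChar hc hd h = initialChar h0 d - initialChar h0 c := by
  classical
  rcases (unitInterval.nonneg' : 0 ≤ c).lt_or_eq with hpos | rfl
  · ext y
    rw [ContinuousMap.sub_apply, initialChar_apply hd (hpos.trans h), initialChar_apply hc hpos]
    have h1 : upper D c ≤ y ↔ ¬ y ≤ lower D c := by
      have hcD : c ∈ D \ {0, 1} :=
        ⟨hc, by simp [hpos.ne', (h.trans_le unitInterval.le_one').ne]⟩
      rw [upper_le, le_lower, not_or, not_lt, le_iff_lt_or_eq, not_and]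
      simp only [hcD, forall_const, Bool.not_eq_false]
      constructor
      · rintro (h | ⟨h, h'⟩)
        · exact ⟨Or.inl h, fun h' => absurd h'.symm h.ne⟩
        · exact ⟨Or.inr h, fun _ => h'⟩
      · rintro ⟨h | h, h'⟩
        · exact Or.inl h
        · exact Or.inr ⟨h, h' h.symm⟩
    have h2 : y ≤ lower D c → y ≤ lower D d := fun hy => hy.trans (le_lower.2 (Or.inl h))
    simp only [intervalChar, ContinuousMap.coe_mk, indicator_apply, mem_Icc, h1, Pi.one_apply]
    by_cases hy : y ≤ lower D c
    · simp [hy, h2 hy]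
    · simp [hy]
  · rw [initialChar_zero, sub_zero, initialChar, dif_pos ⟨hd, h⟩]

lemma initialChar_one_lower_one (h1 : (1 : unitInterval) ∈ D) :
    initialChar h0 1 (lower D 1) = 1 := by
  rw [initialChar_apply h1 zero_lt_one, if_pos le_rfl]

lemma initialChar_lower_one {c : unitInterval} (hc : c < 1) :
    initialChar h0 c (lower D 1) = 0 := by
  by_cases h : c ∈ D ∧ 0 < c
  · rw [initialChar_apply h.1 h.2, if_neg]
    rw [le_lower]
    simp [hc.ne', hc.le]
  · rw [initialChar, dif_neg h]; rfl

lemma jump_initialChar_one (h1 : (1 : unitInterval) ∈ D) : jump (initialChar h0 1) = 0 := by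
  have : ∀ y : Disconnection D, y ≤ lower D 1 := by
    intro y
    rw [le_lower]
    rcases (unitInterval.le_one' : y.collapse ≤ 1).lt_or_eq with h | h
    · exact Or.inl h
    · refine Or.inr ⟨h, ?_⟩
      by_contra hf
      exact (mem_of_flag y (by simpa using hf)).2 (by simp [h])
  ext x
  rw [jump_apply, initialChar_apply h1 zero_lt_one, initialChar_apply h1 zero_lt_one,
    if_pos (this _), if_pos (this _)]
  rfl

lemma jump_initialChar {c : unitInterval} (hc : c ∈ D) (hpos : 0 < c) (hlt : c < 1) :
    jump (initialChar h0 c) = - Finsupp.single c 1 := by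
  classical
  have hcD : c ∈ D \ {0, 1} := ⟨hc, by simp [hpos.ne', hlt.ne]⟩
  ext x
  rw [jump_apply, initialChar_apply hc hpos, initialChar_apply hc hpos, Finsupp.neg_apply,
    Finsupp.single_apply]
  simp only [le_lower, collapse_upper, collapse_lower, flag_upper, flag_lower]
  rcases lt_trichotomy x c with h | rfl | h
  · simp [h, h.ne']
  · simp only [lt_irrefl, hcD]; simp
  · simp [h.ne, h.ne', h.not_gt]

/-- The homomorphism from `C(X, ℤ)` that maps the characteristic function of `[0, c⁻]` to `v c`. -/
def stepHom {V : Type*} [AddCommGroup V] (v : unitInterval → V) : C(Disconnection D, ℤ) →+ V where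
  toFun f := f (lower D 1) • v 1 - (jump f).sum fun c n => n • v c
  map_zero' := by simp
  map_add' f g := by
    rw [map_add, Finsupp.sum_add_index' (by simp) (by simp [add_smul]), ContinuousMap.add_apply,
      add_smul]
    abel

lemma stepHom_apply {V : Type*} [AddCommGroup V] (v : unitInterval → V)
    (f : C(Disconnection D, ℤ)) :
    stepHom v f = f (lower D 1) • v 1 - (jump f).sum fun c n => n • v c := rfl

lemma stepHom_initialChar {V : Type*} [AddCommGroup V] {v : unitInterval → V} (hv : v 0 = 0)
    {c : unitInterval} (hc : c ∈ D) : stepHom v (initialChar h0 c) = v c := by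
  rcases (unitInterval.nonneg' : 0 ≤ c).lt_or_eq with hpos | rfl
  · rcases (unitInterval.le_one' : c ≤ 1).lt_or_eq with hlt | rfl
    · rw [stepHom_apply, initialChar_lower_one hlt, jump_initialChar hc hpos hlt,
        ← Finsupp.single_neg, Finsupp.sum_single_index (by simp)]
      simp
    · rw [stepHom_apply, initialChar_one_lower_one hc, jump_initialChar_one hc]
      simp
  · simp [hv]

lemma mem_of_jump_ne_zero {f : C(Disconnection D, ℤ)} {x : unitInterval} (h : jump f x ≠ 0) :
    x ∈ D \ {0, 1} := by
  by_contra hx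
  exact h (by rw [jump_apply, lower_eq_upper hx, sub_self])

/-- For 0 < c < 1 the function e_c jumps only at c, by -1, and vanishes at 1, while e_1 is
constantly 1. Hence both sides have the same jumps and the same value at 1. -/
lemma stepHom_initialChar_self (h1 : (1 : unitInterval) ∈ D) (f : C(Disconnection D, ℤ)) :
    stepHom (initialChar h0) f = f := by
  have hlt : ∀ c ∈ (jump f).support, c ∈ D ∧ 0 < c ∧ c < 1 := by
    intro c hc
    have := mem_of_jump_ne_zero (Finsupp.mem_support_iff.1 hc)
    simp only [mem_sdiff, mem_insert_iff, mem_singleton_iff, not_or] at this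
    exact ⟨this.1, unitInterval.nonneg'.lt_of_ne' this.2.1, unitInterval.le_one'.lt_of_ne this.2.2⟩
  rw [eq_comm, ← sub_eq_zero]
  apply eq_zero_of_jump_eq_zero
  · rw [map_sub, stepHom_apply, map_sub, map_zsmul, jump_initialChar_one h1, smul_zero, zero_sub,
      sub_neg_eq_add, map_finsuppSum]
    have : ((jump f).sum fun c n => jump (n • initialChar h0 c)) =
        (jump f).sum fun c n => - Finsupp.single c n := by
      refine Finsupp.sum_congr fun c hc => ?_
      rw [map_zsmul, jump_initialChar (hlt c hc).1 (hlt c hc).2.1 (hlt c hc).2.2]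
      simp
    rw [this, Finsupp.sum_neg, Finsupp.sum_single, add_neg_cancel]
  · rw [stepHom_apply, Finsupp.sum, ContinuousMap.sub_apply, ContinuousMap.sub_apply,
      ContinuousMap.smul_apply, initialChar_one_lower_one h1, ContinuousMap.sum_apply,
      Finset.sum_eq_zero]
    · simp
    · intro c hc
      rw [ContinuousMap.smul_apply, initialChar_lower_one (hlt c hc).2.2, smul_zero]

/-- Every homomorphism from `C(X, ℤ)` is determined by its values at the characteristic functions
of the order intervals `[0, c⁻]`. -/
lemma map_eq_stepHom {V : Type*} [AddCommGroup V] (h1 : (1 : unitInterval) ∈ D)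
    (g : C(Disconnection D, ℤ) →+ V) (f : C(Disconnection D, ℤ)) :
    g f = stepHom (fun c => g (initialChar h0 c)) f := by
  conv_lhs => rw [← stepHom_initialChar_self (h0 := h0) h1 f]
  simp only [stepHom_apply, Finsupp.sum, map_sub, map_sum, map_zsmul]

end Disconnection

/-! ### Propagating values along orbits -/

/-- A function on the disjoint infinite orbits of the points `x k` that is compatible with a family
of bijections extends to all points whose orbit meets these orbits. -/
lemma exists_compatible_extension {Y K V : Type*} [Inhabited V] (f : Y → Y) (x : K → Y)
    (hx : Injective fun p : ℕ × K => f^[p.1] (x p.2)) (A : Y → V ≃ V) (s : K → V) :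
    ∃ v : Y → V, (∀ k, v (x k) = s k) ∧
      ∀ c, (∃ m n k, f^[m] c = f^[n] (x k)) → v (f c) = A c (v c) := by
  -- `w n k` is the value forced at the `n`-th point of the orbit of `x k`. Injectivity makes these
  -- points distinct, so `v₀` is well defined on the orbits.
  let w : ℕ → K → V := fun n k => Nat.rec (s k) (fun n u => A (f^[n] (x k)) u) n
  let v₀ : Y → V := Function.extend (fun p : ℕ × K => f^[p.1] (x p.2)) (fun p => w p.1 p.2)
    fun _ => default
  have hv₀ : ∀ n k, v₀ (f^[n] (x k)) = w n k := fun n k => hx.extend_apply _ _ (n, k)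
  -- `u m c` moves `m` steps forward, reads off `v₀` and pulls the value back through the inverse
  -- bijections. Once the orbit has been reached, further steps do not change the result.
  let u : ℕ → Y → V := fun m => Nat.rec v₀ (fun _ g c => (A c).symm (g (f c))) m
  have hu : ∀ m c, u (m + 1) c = (A c).symm (u m (f c)) := fun _ _ => rfl
  have hstep : ∀ m c, (∃ n k, f^[m] c = f^[n] (x k)) → u (m + 1) c = u m c := by
    intro m
    induction m with
    | zero =>
      rintro c ⟨n, k, rfl : c = f^[n] (x k)⟩
      rw [hu, Equiv.symm_apply_eq]
      change v₀ (f (f^[n] (x k))) = A _ (v₀ _)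
      rw [← iterate_succ_apply' f, hv₀, hv₀]
    | succ m ih =>
      intro c hc
      rw [hu (m + 1), ih (f c) (by simpa only [iterate_succ_apply] using hc), ← hu]
  have hsucc : ∀ m c, (∃ n k, f^[m] c = f^[n] (x k)) →
      ∃ n k, f^[m + 1] c = f^[n] (x k) := by
    rintro m c ⟨n, k, h⟩
    exact ⟨n + 1, k, by rw [iterate_succ_apply', h, iterate_succ_apply']⟩
  have hle : ∀ m c, (∃ n k, f^[m] c = f^[n] (x k)) → ∀ j, (∃ n k, f^[m + j] c = f^[n] (x k)) ∧
      u (m + j) c = u m c := by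
    intro m c hc j
    induction j with
    | zero => exact ⟨hc, rfl⟩
    | succ j ih => exact ⟨hsucc _ c ih.1, (hstep _ c ih.1).trans ih.2⟩
  have heq : ∀ m m' c, (∃ n k, f^[m] c = f^[n] (x k)) → (∃ n k, f^[m'] c = f^[n] (x k)) →
      u m c = u m' c := by
    intro m m' c h h'
    rw [← (hle m c h m').2, ← (hle m' c h' m).2, add_comm]
  classical
  let v : Y → V := fun c => if h : ∃ m n k, f^[m] c = f^[n] (x k) then u h.choose c else default
  have hv : ∀ m c, (∃ n k, f^[m] c = f^[n] (x k)) → v c = u m c := by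
    intro m c h
    have h' : ∃ m n k, f^[m] c = f^[n] (x k) := ⟨m, h⟩
    simp only [v, dif_pos h']
    exact heq _ _ _ h'.choose_spec h
  refine ⟨v, fun k => (hv 0 _ ⟨0, k, rfl⟩).trans (hv₀ 0 k), fun c ⟨m, h⟩ => ?_⟩
  have h' := hsucc m c h
  rw [hv (m + 1) c h', hu, Equiv.apply_symm_apply]
  exact hv m (f c) (by simpa only [iterate_succ_apply] using h')

/-- A coincidence of the m-th and n-th iterates with m < n makes the orbit eventually periodic: any
index k ≥ n can be lowered to k - n + m, so the first n iterates exhaust the orbit. -/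
lemma injective_iterate_of_infinite {Y : Type*} {f : Y → Y} {x : Y}
    (h : (forwardOrbit f x).Infinite) : Injective fun n : ℕ => f^[n] x := by
  have key : ∀ m n, m < n → f^[m] x ≠ f^[n] x := by
    intro m n hmn heq
    refine h (((finite_Iio n).image fun n => f^[n] x).subset ?_)
    rintro _ ⟨k, rfl⟩
    induction k using Nat.strong_induction_on with
    | _ k ih =>
      by_cases hk : k < n
      · exact ⟨k, hk, rfl⟩
      · have : f^[k] x = f^[k - n + m] x := by
          rw [iterate_add_apply, heq, ← iterate_add_apply, Nat.sub_add_cancel (not_lt.1 hk)]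
        simp only [this]
        exact ih _ (by omega)
  intro m n heq
  rcases lt_trichotomy m n with h | h | h
  · exact absurd heq (key m n h)
  · exact h
  · exact absurd heq.symm (key n m h)

lemma exists_sum_of_differences {V : Type*} [AddCommGroup V] {q : ℕ} (d : Fin q → V)
    (z : Fin (q + 1)) :
    ∃ u : Fin (q + 1) → V, u z = 0 ∧ ∀ i : Fin q, u i.succ - u i.castSucc = d i := by
  let U : Fin (q + 1) → V := Fin.induction 0 fun i x => x + d i
  refine ⟨fun k => U k - U z, sub_self _, fun i => ?_⟩
  have : U i.succ = U i.castSucc + d i := Fin.induction_succ _ _ _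
  rw [sub_sub_sub_cancel_right, this, add_sub_cancel_left]

/-- The last difference is left unconstrained, so it can affect only the last value. -/
lemma eq_of_differences_eq {V : Type*} [AddCommGroup V] {q : ℕ} {u u' : Fin (q + 1) → V}
    {z : Fin (q + 1)} (hz : z ≠ Fin.last q) (h : u z = u' z)
    (hd : ∀ i : Fin q, i.succ ≠ Fin.last q → u i.succ - u i.castSucc = u' i.succ - u' i.castSucc)
    {k : Fin (q + 1)} (hk : k ≠ Fin.last q) : u k = u' k := by
  have key : ∀ k : Fin (q + 1), k ≠ Fin.last q → u k - u' k = u 0 - u' 0 := by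
    intro k
    induction k using Fin.induction with
    | zero => exact fun _ => rfl
    | succ i ih =>
      intro hi
      rw [← ih (Fin.castSucc_lt_last i).ne, sub_eq_sub_iff_sub_eq_sub]
      exact hd i hi
  have := (key k hk).trans (key z hz).symm
  rwa [h, sub_self, sub_eq_zero] at this

/-- Values `s` at the partition points, other than the last one, determine its value, and the
values `u` at the images, if `s` and `u` are to satisfy the transfer relations on the pieces. -/
lemma exists_partition_values {V : Type*} [AddCommGroup V] {q : ℕ} (g : Fin q → V → V)
    {i₀ j₀ : Fin (q + 1)} (hi₀ : i₀ ≠ Fin.last q) (hj₀ : j₀ ≠ Fin.last q) (s : Fin (q + 1) → V) :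
    ∃ s' u : Fin (q + 1) → V, (∀ k ≠ Fin.last q, s' k = s k) ∧ u i₀ = 0 ∧
      s' (Fin.last q) = u j₀ ∧
      ∀ i : Fin q, u i.succ - u i.castSucc = g i (s' i.succ - s' i.castSucc) := by
  -- Changing the last value of `s` alters only the last difference, hence not the entry at `j₀`. So
  -- that entry can be computed from `s` first and then installed as the last value, without
  -- circularity.
  obtain ⟨U, hU, hUd⟩ := exists_sum_of_differences (fun i => g i (s i.succ - s i.castSucc)) i₀
  let s' := update s (Fin.last q) (U j₀)
  have hs' : ∀ k ≠ Fin.last q, s' k = s k := fun k hk => update_of_ne hk _ _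
  obtain ⟨u, hu, hud⟩ := exists_sum_of_differences (fun i => g i (s' i.succ - s' i.castSucc)) i₀
  refine ⟨s', u, hs', hu, ?_, hud⟩
  have : U j₀ = u j₀ := eq_of_differences_eq hi₀ (hU.trans hu.symm) (fun i hi => by
    rw [hUd, hud, hs' _ hi, hs' _ (Fin.castSucc_lt_last i).ne]) hj₀
  rw [← this]
  exact update_self _ _ _

/-! ### Strictly monotone maps and order intervals -/

/-- Order convexity of the image supplies a preimage in `s` of each intermediate value; strict
monotonicity then places it between `y` and `z`. -/
lemma StrictMonoOn.image_Icc_eq {α β : Type*} [LinearOrder α] [LinearOrder β] {f : α → β}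
    {s : Set α} (hf : StrictMonoOn f s) (hs : OrdConnected s) (hs' : OrdConnected (f '' s))
    {y z : α} (hy : y ∈ s) (hz : z ∈ s) : f '' Icc y z = Icc (f y) (f z) := by
  refine Subset.antisymm ?_ fun w hw => ?_
  · rintro _ ⟨x, hx, rfl⟩
    have hxs := hs.out hy hz hx
    exact ⟨hf.monotoneOn hy hxs hx.1, hf.monotoneOn hxs hz hx.2⟩
  · obtain ⟨x, hx, rfl⟩ := hs'.out (mem_image_of_mem f hy) (mem_image_of_mem f hz) hw
    exact ⟨x, ⟨(hf.le_iff_le hy hx).1 hw.1, (hf.le_iff_le hx hz).1 hw.2⟩, rfl⟩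

lemma StrictAntiOn.image_Icc_eq {α β : Type*} [LinearOrder α] [LinearOrder β] {f : α → β}
    {s : Set α} (hf : StrictAntiOn f s) (hs : OrdConnected s) (hs' : OrdConnected (f '' s))
    {y z : α} (hy : y ∈ s) (hz : z ∈ s) : f '' Icc y z = Icc (f z) (f y) := by
  refine Subset.antisymm ?_ fun w hw => ?_
  · rintro _ ⟨x, hx, rfl⟩
    have hxs := hs.out hy hz hx
    exact ⟨hf.antitoneOn hxs hz hx.2, hf.antitoneOn hy hxs hx.1⟩
  · obtain ⟨x, hx, rfl⟩ := hs'.out (mem_image_of_mem f hz) (mem_image_of_mem f hy) hw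
    exact ⟨x, ⟨(hf.le_iff_ge hx hy).1 hw.2, (hf.le_iff_ge hz hx).1 hw.1⟩, rfl⟩

lemma transferFun_indicator_one {X : Type*} {σ : X → X} {E : Set X} (hE : InjOn σ E) :
    transferFun σ (E.indicator 1) = (σ '' E).indicator 1 := by
  funext x
  have hz : ∀ y ∉ E, E.indicator (1 : X → ℤ) y = 0 := fun y hy => indicator_of_notMem hy _
  by_cases hx : x ∈ σ '' E
  · obtain ⟨y, hy, rfl⟩ := hx
    rw [transferFun_of_injOn hE hz hy, indicator_of_mem hy,
      indicator_of_mem (mem_image_of_mem σ hy)]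
    rfl
  · rw [transferFun_of_notMem hz hx, indicator_of_notMem hx]

namespace MultimodalMap

open Disconnection

variable {q : ℕ} (τ : MultimodalMap q)

/-! ### The transfer map on order intervals -/

lemma zero_mem : (0 : unitInterval) ∈ τ.generalizedOrbit := τ.a_zero ▸ τ.a_mem 0

lemma one_mem : (1 : unitInterval) ∈ τ.generalizedOrbit := τ.a_last ▸ τ.a_mem _

open Classical in
/-- The sign of `τ` on a piece. -/
def sign (i : Fin q) : ℤ :=
  if StrictMonoOn τ.toFun (Ioo (τ.a i.castSucc) (τ.a i.succ)) then 1 else -1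

lemma sign_mul_self (i : Fin q) : τ.sign i * τ.sign i = 1 := by
  unfold sign; split_ifs <;> rfl

/-- The closed interval `[a_{i-1}, a_i]`, the closure of an interval of monotonicity. -/
abbrev lap (i : Fin q) : Set unitInterval := Icc (τ.a i.castSucc) (τ.a i.succ)

lemma exists_mem_lap (x : unitInterval) : ∃ i, x ∈ τ.lap i := by
  obtain ⟨i, hi⟩ := mem_iUnion.1 (τ.iUnion_piece.symm ▸ mem_univ (lower _ x) :
    lower _ x ∈ ⋃ i, τ.piece i)
  exact ⟨i, τ.collapse_mem_Icc hi⟩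

lemma ordConnected_image_piece (i : Fin q) : OrdConnected (τ.localHomeo '' τ.piece i) := by
  rcases τ.monotonic i with h | h
  · rw [τ.image_piece_of_mono h]; exact ordConnected_Icc
  · rw [τ.image_piece_of_anti h]; exact ordConnected_Icc

/-- The characteristic function of the order interval `[0, c⁻]` of `X`. -/
abbrev initial (c : unitInterval) : C(τ.Space, ℤ) := initialChar τ.zero_mem c

/-- For c < d the difference is the characteristic function of [c⁺, d⁻], which lies in a single
piece. There σ is injective and monotone, so 𝓛 gives the characteristic function of the image, again
an order interval; if τ decreases, its ends are swapped, which accounts for the sign. -/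
lemma transfer_initial_sub {i : Fin q} {c d : unitInterval} (hc : c ∈ τ.generalizedOrbit)
    (hd : d ∈ τ.generalizedOrbit) (hci : c ∈ τ.lap i) (hdi : d ∈ τ.lap i) :
    τ.isPiecewiseHomeo_localHomeo.transfer (τ.initial d - τ.initial c) =
      τ.sign i • (τ.initial (τ.toFun d) - τ.initial (τ.toFun c)) := by
  wlog hcd : c < d generalizing c d
  · rcases (not_lt.1 hcd).lt_or_eq with h | rfl
    · rw [← neg_sub, map_neg, this hd hc hdi hci h, ← smul_neg, neg_sub]
    · simp
  have hyr : (upper τ.generalizedOrbit c).flag = true ∨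
      (upper τ.generalizedOrbit c).collapse = 0 := by
    by_cases h0 : c = 0
    · exact Or.inr h0
    · left
      have : c ∈ τ.generalizedOrbit \ {0, 1} :=
        ⟨hc, by simp [h0, (hcd.trans_le unitInterval.le_one').ne]⟩
      simp only [flag_upper, this, decide_true]
  have hzr : ¬ ((lower τ.generalizedOrbit d).flag = true ∨
      (lower τ.generalizedOrbit d).collapse = 0) := by
    simp [(unitInterval.nonneg'.trans_lt hcd).ne']
  have hy : upper _ c ∈ τ.piece i := τ.mem_piece.2
    ⟨hci.1.lt_or_eq.imp id fun h => ⟨h, hyr⟩, Or.inl (hcd.trans_le hdi.2)⟩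
  have hz : lower _ d ∈ τ.piece i := τ.mem_piece.2
    ⟨Or.inl (hci.1.trans_lt hcd), hdi.2.lt_or_eq.imp id fun h => ⟨h, rfl⟩⟩
  have hsub : Icc (upper _ c) (lower _ d) ⊆ τ.piece i := ordConnected_Icc.out hy hz
  have hinj : InjOn τ.localHomeo (Icc (upper _ c) (lower _ d)) :=
    (τ.localHomeo_piece i).1.mono hsub
  rw [← intervalChar_eq_sub hc hd hcd]
  rcases τ.monotonic i with h | h
  · have hlt := strictMonoOn_Icc_of_Ioo τ.continuous_toFun h hci hdi hcd
    rw [sign, if_pos h, one_smul, ← intervalChar_eq_sub (τ.map_mem hc) (τ.map_mem hd) hlt]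
    ext x
    change transferFun τ.localHomeo ((Icc (upper _ c) (lower _ d)).indicator 1) x =
      (Icc (upper _ (τ.toFun c)) (lower _ (τ.toFun d))).indicator 1 x
    rw [transferFun_indicator_one hinj, (τ.strictMonoOn_localHomeo h).image_Icc_eq
      ordConnected_Icc (τ.ordConnected_image_piece i) hy hz, τ.localHomeo_of_mono hy h,
      τ.localHomeo_of_mono hz h, if_pos hyr, if_neg hzr]
    rfl
  · have hlt := strictAntiOn_Icc_of_Ioo τ.continuous_toFun h hci hdi hcd
    have hn : ¬ StrictMonoOn τ.toFun (Ioo (τ.a i.castSucc) (τ.a i.succ)) := fun h' =>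
      (strictMonoOn_Icc_of_Ioo τ.continuous_toFun h' hci hdi hcd).not_gt hlt
    rw [sign, if_neg hn, neg_one_smul, neg_sub,
      ← intervalChar_eq_sub (τ.map_mem hd) (τ.map_mem hc) hlt]
    ext x
    change transferFun τ.localHomeo ((Icc (upper _ c) (lower _ d)).indicator 1) x =
      (Icc (upper _ (τ.toFun d)) (lower _ (τ.toFun c))).indicator 1 x
    rw [transferFun_indicator_one hinj, (τ.strictAntiOn_localHomeo h).image_Icc_eq
      ordConnected_Icc (τ.ordConnected_image_piece i) hy hz, τ.localHomeo_of_anti hy h,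
      τ.localHomeo_of_anti hz h, if_pos hyr, if_neg hzr]
    rfl

/-- Two functions on the generalized orbit that vanish at `0` and have the same differences on
each lap are equal. -/
lemma eqOn_of_sub_eq_sub {V : Type*} [AddCommGroup V] {v w : unitInterval → V} (h0 : v 0 = w 0)
    (h : ∀ i, ∀ c ∈ τ.generalizedOrbit, ∀ d ∈ τ.generalizedOrbit, c ∈ τ.lap i → d ∈ τ.lap i →
      v d - v c = w d - w c) : EqOn v w τ.generalizedOrbit := by
  -- Neighbouring laps share a partition point, so equality spreads from 0 through all of them.
  have ha : ∀ k, v (τ.a k) = w (τ.a k) := by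
    intro k
    induction k using Fin.induction with
    | zero => rwa [τ.a_zero]
    | succ i ih =>
      have := h i _ (τ.a_mem i.castSucc) _ (τ.a_mem i.succ) (left_mem_Icc.2 (τ.a_lt i).le)
        (right_mem_Icc.2 (τ.a_lt i).le)
      rwa [ih, sub_left_inj] at this
  intro c hc
  obtain ⟨i, hi⟩ := τ.exists_mem_lap c
  have := h i _ (τ.a_mem i.castSucc) c hc (left_mem_Icc.2 (τ.a_lt i).le) hi
  rwa [ha, sub_left_inj] at this

/-! ### Preimages of the endpoints -/

/-- Inside a lap τ takes no extreme value, so 0 and 1 can be attained only at partition points. -/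
lemma lt_of_mem_Ioo {i : Fin q} {x : unitInterval}
    (hx : x ∈ Ioo (τ.a i.castSucc) (τ.a i.succ)) :
    (∃ y, τ.toFun y < τ.toFun x) ∧ ∃ y, τ.toFun x < τ.toFun y := by
  have hxI := Ioo_subset_Icc_self hx
  have hl : τ.a i.castSucc ∈ τ.lap i := left_mem_Icc.2 (τ.a_lt i).le
  have hr : τ.a i.succ ∈ τ.lap i := right_mem_Icc.2 (τ.a_lt i).le
  rcases τ.monotonic i with h | h
  · have hI := strictMonoOn_Icc_of_Ioo τ.continuous_toFun h
    exact ⟨⟨_, hI hl hxI hx.1⟩, ⟨_, hI hxI hr hx.2⟩⟩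
  · have hI := strictAntiOn_Icc_of_Ioo τ.continuous_toFun h
    exact ⟨⟨_, hI hxI hr hx.2⟩, ⟨_, hI hl hxI hx.1⟩⟩

/-- An endpoint that is not the image of an endpoint is the image of an inner partition point. -/
lemma exists_map_a_eq (hs : Surjective τ.toFun) (h01 : τ.toFun '' {0, 1} ∩ {0, 1} = ∅)
    {e : unitInterval} (he : e ∈ ({0, 1} : Set unitInterval)) :
    ∃ k, k ≠ 0 ∧ k ≠ Fin.last q ∧ τ.toFun (τ.a k) = e := by
  obtain ⟨x, rfl⟩ := hs e
  have hx : ∃ k, τ.a k = x := by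
    obtain ⟨i, hi⟩ := τ.exists_mem_lap x
    rcases hi.1.lt_or_eq with h1 | h1
    · rcases hi.2.lt_or_eq with h2 | h2
      · obtain ⟨⟨y, hy⟩, ⟨z, hz⟩⟩ := τ.lt_of_mem_Ioo ⟨h1, h2⟩
        rcases he with he | he
        · exact absurd (he ▸ hy) (not_lt.2 unitInterval.nonneg')
        · exact absurd (mem_singleton_iff.1 he ▸ hz) (not_lt.2 unitInterval.le_one')
      · exact ⟨_, h2.symm⟩
    · exact ⟨_, h1⟩
  obtain ⟨k, rfl⟩ := hx
  have hne : τ.a k ∉ ({0, 1} : Set unitInterval) := fun h =>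
    (eq_empty_iff_forall_notMem.1 h01 _) ⟨mem_image_of_mem _ h, he⟩
  refine ⟨k, ?_, ?_, rfl⟩
  · rintro rfl
    exact hne (by simp [τ.a_zero])
  · rintro rfl
    exact hne (by simp [τ.a_last])

/-- Of the partition points, a lap contains only its endpoints. -/
lemma a_mem_lap {i : Fin q} {k : Fin (q + 1)} (h : τ.a k ∈ τ.lap i) :
    k = i.castSucc ∨ k = i.succ := by
  have h1 := τ.a_strictMono.le_iff_le.1 h.1
  have h2 := τ.a_strictMono.le_iff_le.1 h.2
  rw [Fin.le_def] at h1 h2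
  simp only [Fin.ext_iff, Fin.val_castSucc, Fin.val_succ] at h1 h2 ⊢
  omega

/-- A point other than the partition points is contained in only one lap. -/
lemma lap_unique {i j : Fin q} {x : unitInterval} (hx : x ∉ range τ.a) (hi : x ∈ τ.lap i)
    (hj : x ∈ τ.lap j) : i = j := by
  have key : ∀ i j : Fin q, i < j → x ∈ τ.lap i → x ∈ τ.lap j → False := by
    intro i j hij hi hj
    have hle : τ.a i.succ ≤ τ.a j.castSucc := τ.a_strictMono.monotone (by
      rw [Fin.le_def]; simpa using hij)
    exact hx ⟨_, le_antisymm (hle.trans hj.1) hi.2⟩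
  rcases lt_trichotomy i j with h | h | h
  · exact (key i j h hi hj).elim
  · exact h
  · exact (key j i h hj hi).elim

/-! ### Constructing equivariant functions on the generalized orbit -/

section Module

variable {V : Type*} [AddCommGroup V] [Module ℤ[T;T⁻¹] V]

open LaurentPolynomial (T)

/-- `x ↦ u + ε t (x - s)` as a bijection. -/
def affineEquiv (ε : ℤ) (hε : ε * ε = 1) (s u : V) : V ≃ V where
  toFun x := u + ε • (T 1 : ℤ[T;T⁻¹]) • (x - s)
  invFun y := s + ε • (T (-1) : ℤ[T;T⁻¹]) • (y - u)
  left_inv x := by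
    simp only [add_sub_cancel_left]
    rw [smul_comm (T (-1) : ℤ[T;T⁻¹]) ε, smul_smul ε, hε, one_smul, smul_smul,
      ← LaurentPolynomial.T_add]
    simp
  right_inv x := by
    simp only [add_sub_cancel_left]
    rw [smul_comm (T 1 : ℤ[T;T⁻¹]) ε, smul_smul ε, hε, one_smul, smul_smul,
      ← LaurentPolynomial.T_add]
    simp

/-- Arbitrary values at the inner partition points extend to a function that transforms under `τ`
as the classes of the order intervals `[0, c⁻]` do. -/
lemma exists_equivariant_values (hs : Surjective τ.toFun)
    (horb_inf : ∀ i : Fin (q + 1), i ≠ 0 → i ≠ Fin.last q →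
      (forwardOrbit τ.toFun (τ.a i)).Infinite)
    (horb_disj : ∀ i j : Fin (q + 1), i ≠ 0 → i ≠ Fin.last q → j ≠ 0 → j ≠ Fin.last q → i ≠ j →
      Disjoint (forwardOrbit τ.toFun (τ.a i)) (forwardOrbit τ.toFun (τ.a j)))
    (h01 : τ.toFun '' {0, 1} ∩ {0, 1} = ∅) (s : Fin (q + 1) → V) (hs0 : s 0 = 0) :
    ∃ v : unitInterval → V, v 0 = 0 ∧ (∀ k, k ≠ Fin.last q → v (τ.a k) = s k) ∧
      ∀ i, ∀ c ∈ τ.generalizedOrbit, ∀ d ∈ τ.generalizedOrbit, c ∈ τ.lap i → d ∈ τ.lap i →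
        (T 1 : ℤ[T;T⁻¹]) • (v d - v c) = τ.sign i • (v (τ.toFun d) - v (τ.toFun c)) := by
  obtain ⟨i₀, hi0, hil, hi₀⟩ := τ.exists_map_a_eq hs h01 (show (0 : unitInterval) ∈ _ by simp)
  obtain ⟨j₀, hj0, hjl, hj₀⟩ := τ.exists_map_a_eq hs h01 (show (1 : unitInterval) ∈ _ by simp)
  -- `s' k` is the intended value at `a k`, and `u k` the one at its image under `τ`. The anchors
  -- encode v(τ(a_{i₀})) = 0 and v(τ(a_{j₀})) = v(1).
  obtain ⟨s', u, hs', hu0, hu1, hu⟩ := exists_partition_values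
    (fun i x => τ.sign i • (T 1 : ℤ[T;T⁻¹]) • x) hil hjl s
  have h0l : (0 : Fin (q + 1)) ≠ Fin.last q := fun h => by
    rw [← Fin.val_inj, Fin.val_last] at h
    exact hi0 (Fin.ext (by have := i₀.2; simp at h ⊢; omega))
  let A : Fin q → V ≃ V := fun i =>
    affineEquiv (τ.sign i) (τ.sign_mul_self i) (s' i.castSucc) (u i.castSucc)
  have hA : ∀ i x, A i x = u i.castSucc + τ.sign i • (T 1 : ℤ[T;T⁻¹]) • (x - s' i.castSucc) :=
    fun _ _ => rfl
  -- Thus the affine maps of two adjacent laps agree at their common partition point.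
  have hAa : ∀ i k, τ.a k ∈ τ.lap i → A i (s' k) = u k := by
    intro i k hk
    rcases τ.a_mem_lap hk with rfl | rfl
    · rw [hA, sub_self, smul_zero, smul_zero, add_zero]
    · rw [hA, ← hu, add_sub_cancel]
  choose p hp using τ.exists_mem_lap
  let _ : Inhabited V := ⟨0⟩
  obtain ⟨v, hvs, hv⟩ := exists_compatible_extension τ.toFun
    (fun k : {k : Fin (q + 1) // k ≠ 0 ∧ k ≠ Fin.last q} => τ.a k) (by
      rintro ⟨n, k⟩ ⟨m, l⟩ h
      have hkl : k = l := by
        by_contra hne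
        exact Set.disjoint_left.1 (horb_disj k l k.2.1 k.2.2 l.2.1 l.2.2
          fun h' => hne (Subtype.ext h')) ⟨n, rfl⟩ ⟨m, h.symm⟩
      subst hkl
      exact congrArg (·, k) (injective_iterate_of_infinite (horb_inf k k.2.1 k.2.2) h))
    (fun c => A (p c)) (fun k => s' k)
  -- The points whose orbits meet an inner orbit form a set closed under τ and τ⁻¹. It contains 0
  -- and 1 as images of a_{i₀} and a_{j₀}, so by minimality it contains I₁.
  replace hv : ∀ c ∈ τ.generalizedOrbit, v (τ.toFun c) = A (p c) (v c) := by
    refine fun c hc => hv c (mem_sInter.1 hc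
      {c | ∃ m n, ∃ k : {k : Fin (q + 1) // k ≠ 0 ∧ k ≠ Fin.last q}, τ.toFun^[m] c = τ.toFun^[n] (τ.a k)} ⟨?_, ?_, ?_⟩)
    · rintro _ ⟨k, rfl⟩
      by_cases hk0 : k = 0
      · exact ⟨0, 1, ⟨i₀, hi0, hil⟩, by simp [hk0, τ.a_zero, hi₀]⟩
      by_cases hkl : k = Fin.last q
      · exact ⟨0, 1, ⟨j₀, hj0, hjl⟩, by simp [hkl, τ.a_last, hj₀]⟩
      exact ⟨0, 0, ⟨k, hk0, hkl⟩, rfl⟩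
    · rintro _ ⟨c, ⟨m, n, k, h⟩, rfl⟩
      exact ⟨m, n + 1, k, by rw [← iterate_succ_apply, iterate_succ_apply', h,
        iterate_succ_apply']⟩
    · rintro c ⟨m, n, k, h⟩
      exact ⟨m + 1, n, k, by rwa [iterate_succ_apply]⟩
  have hinner : ∀ k, k ≠ 0 → k ≠ Fin.last q → v (τ.a k) = s' k ∧ v (τ.toFun (τ.a k)) = u k := by
    intro k hk0 hkl
    have h := hvs ⟨k, hk0, hkl⟩
    refine ⟨h, ?_⟩
    rw [hv _ (τ.a_mem k)]
    exact (congrArg _ h).trans (hAa _ _ (hp _))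
  have hv0 : v 0 = 0 := by rw [← hi₀, (hinner i₀ hi0 hil).2, hu0]
  have hv1 : v 1 = s' (Fin.last q) := by rw [← hj₀, (hinner j₀ hj0 hjl).2, hu1]
  have hva : ∀ k, v (τ.a k) = s' k := by
    intro k
    by_cases hk0 : k = 0
    · rw [hk0, τ.a_zero, hv0, hs' _ h0l, hs0]
    by_cases hkl : k = Fin.last q
    · rw [hkl, τ.a_last, hv1]
    exact (hinner k hk0 hkl).1
  -- The arbitrary choice of lap `p c` is harmless: only partition points lie in two laps, and there
  -- the affine maps agree.
  have hvA : ∀ i, ∀ c ∈ τ.generalizedOrbit, c ∈ τ.lap i → v (τ.toFun c) = A i (v c) := by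
    intro i c hc hci
    rw [hv c hc]
    by_cases hca : c ∈ range τ.a
    · obtain ⟨k, rfl⟩ := hca
      rw [hva, hAa _ _ (hp _), hAa _ _ hci]
    · rw [τ.lap_unique hca (hp c) hci]
  refine ⟨v, hv0, fun k hk => (hva k).trans (hs' k hk), fun i c hc d hd hci hdi => ?_⟩
  rw [hvA i c hc hci, hvA i d hd hdi, hA, hA, add_sub_add_left_eq_sub, ← smul_sub, ← smul_sub,
    sub_sub_sub_cancel_right, smul_smul, τ.sign_mul_self, one_smul]

end Module

end MultimodalMap

/-! ### Linearity over Laurent polynomials -/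

/-- An additive map between `ℤ[t,t⁻¹]`-modules that commutes with `t` is linear. -/
def AddMonoidHom.toLaurentLinearMap {G V : Type*} [AddCommGroup G] [AddCommGroup V]
    [Module ℤ[T;T⁻¹] G] [Module ℤ[T;T⁻¹] V] (F : G →+ V)
    (hF : ∀ x, F ((LaurentPolynomial.T 1 : ℤ[T;T⁻¹]) • x) =
      (LaurentPolynomial.T 1 : ℤ[T;T⁻¹]) • F x) : G →ₗ[ℤ[T;T⁻¹]] V where
  toFun := F
  map_add' := F.map_add
  map_smul' p x := by
    have hnat : ∀ (n : ℕ) x, F ((LaurentPolynomial.T n : ℤ[T;T⁻¹]) • x) =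
        (LaurentPolynomial.T n : ℤ[T;T⁻¹]) • F x := by
      intro n
      induction n with
      | zero => simp
      | succ n ih =>
        intro x
        rw [Nat.cast_succ, LaurentPolynomial.T_add, mul_smul, ih, hF, mul_smul]
    have hint : ∀ (n : ℤ) x, F ((LaurentPolynomial.T n : ℤ[T;T⁻¹]) • x) =
        (LaurentPolynomial.T n : ℤ[T;T⁻¹]) • F x := by
      intro n x
      obtain ⟨m, rfl | rfl⟩ := n.eq_nat_or_neg
      · exact hnat m x
      · have h := hnat m ((LaurentPolynomial.T (-m : ℤ) : ℤ[T;T⁻¹]) • x)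
        rw [smul_smul, ← LaurentPolynomial.T_add, add_neg_cancel, LaurentPolynomial.T_zero,
          one_smul] at h
        rw [h, smul_smul, ← LaurentPolynomial.T_add, neg_add_cancel, LaurentPolynomial.T_zero,
          one_smul]
    rw [RingHom.id_apply]
    induction p using LaurentPolynomial.induction_on' with
    | add p p' hp hp' => rw [add_smul, map_add, hp, hp', add_smul]
    | C_mul_T n a =>
      rw [eq_intCast LaurentPolynomial.C a, mul_smul, mul_smul, Int.cast_smul_eq_zsmul,
        Int.cast_smul_eq_zsmul, map_zsmul, hint]

/-! ### Spanning and independence -/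

namespace MultimodalMap

open Disconnection
open LaurentPolynomial (T)

variable {q : ℕ} (τ : MultimodalMap q)

variable {G : Type*} [AddCommGroup G] [Module ℤ[T;T⁻¹] G] {φ : C(τ.Space, ℤ) →+ G}

lemma smul_map_initial_sub
    (hφ : ∀ f, φ (τ.isPiecewiseHomeo_localHomeo.transfer f) = (T 1 : ℤ[T;T⁻¹]) • φ f)
    {i : Fin q} {c d : unitInterval} (hc : c ∈ τ.generalizedOrbit)
    (hd : d ∈ τ.generalizedOrbit) (hci : c ∈ τ.lap i) (hdi : d ∈ τ.lap i) :
    (T 1 : ℤ[T;T⁻¹]) • (φ (τ.initial d) - φ (τ.initial c)) =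
      τ.sign i • (φ (τ.initial (τ.toFun d)) - φ (τ.initial (τ.toFun c))) := by
  rw [← map_sub, ← hφ, τ.transfer_initial_sub hc hd hci hdi, map_zsmul, map_sub]

/-- A submodule that contains the classes of `[0, a_k⁻]` for `k < q` contains all classes. -/
lemma map_mem_of_initial_mem (hs : Surjective τ.toFun)
    (h01 : τ.toFun '' {0, 1} ∩ {0, 1} = ∅)
    (hφ : ∀ f, φ (τ.isPiecewiseHomeo_localHomeo.transfer f) = (T 1 : ℤ[T;T⁻¹]) • φ f)
    {N : Submodule ℤ[T;T⁻¹] G} (hN : ∀ k, k ≠ Fin.last q → φ (τ.initial (τ.a k)) ∈ N)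
    (f : C(τ.Space, ℤ)) : φ f ∈ N := by
  obtain ⟨i₀, hi0, hil, hi₀⟩ := τ.exists_map_a_eq hs h01 (show (0 : unitInterval) ∈ _ by simp)
  obtain ⟨j₀, hj0, hjl, hj₀⟩ := τ.exists_map_a_eq hs h01 (show (1 : unitInterval) ∈ _ by simp)
  -- Both t and the sign act invertibly, so membership passes in both directions.
  have hrel : ∀ i, ∀ c ∈ τ.generalizedOrbit, ∀ d ∈ τ.generalizedOrbit, c ∈ τ.lap i →
      d ∈ τ.lap i → (φ (τ.initial d) - φ (τ.initial c) ∈ N ↔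
        φ (τ.initial (τ.toFun d)) - φ (τ.initial (τ.toFun c)) ∈ N) := by
    intro i c hc d hd hci hdi
    have h := τ.smul_map_initial_sub hφ hc hd hci hdi
    constructor
    · intro hN
      have := N.smul_mem (T 1) hN
      rw [h] at this
      have h2 := N.toAddSubgroup.zsmul_mem this (τ.sign i)
      rwa [smul_smul, τ.sign_mul_self, one_smul] at h2
    · intro hN
      have := N.toAddSubgroup.zsmul_mem hN (τ.sign i)
      rw [← h] at this
      have h2 := N.smul_mem (T (-1)) this
      rwa [smul_smul, ← LaurentPolynomial.T_add, neg_add_cancel, LaurentPolynomial.T_zero,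
        one_smul] at h2
  have hl : ∀ i, τ.a i.castSucc ∈ τ.lap i := fun i => left_mem_Icc.2 (τ.a_lt i).le
  have hr : ∀ i, τ.a i.succ ∈ τ.lap i := fun i => right_mem_Icc.2 (τ.a_lt i).le
  -- The last lap involves e_1, whose class is not yet known to lie in `N`; hence the second part is
  -- conditional. The first part avoids that lap and starts from e_{τ(a_{i₀})} = e_0 = 0.
  have himg : (∀ k, k ≠ Fin.last q → φ (τ.initial (τ.toFun (τ.a k))) ∈ N) ∧
      ((∀ k, φ (τ.initial (τ.a k)) ∈ N) → ∀ k, φ (τ.initial (τ.toFun (τ.a k))) ∈ N) := by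
    have key : ∀ i : Fin q, φ (τ.initial (τ.a i.succ)) ∈ N →
        (φ (τ.initial (τ.toFun (τ.a i.succ))) - φ (τ.initial (τ.toFun (τ.a i.castSucc))) ∈ N) :=
      fun i hi => (hrel i _ (τ.a_mem _) _ (τ.a_mem _) (hl i) (hr i)).1
        (N.sub_mem hi (hN _ (Fin.castSucc_lt_last i).ne))
    have h0 : φ (τ.initial (τ.toFun (τ.a i₀))) = 0 := by
      rw [hi₀, initial, initialChar_zero, map_zero]
    have hdiff : ∀ k, k ≠ Fin.last q →
        φ (τ.initial (τ.toFun (τ.a k))) - φ (τ.initial (τ.toFun (τ.a 0))) ∈ N := by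
      intro k
      induction k using Fin.induction with
      | zero => intro _; rw [sub_self]; exact N.zero_mem
      | succ i ih =>
        intro hi
        rw [← sub_add_sub_cancel]
        exact N.add_mem (key i (hN _ hi)) (ih (Fin.castSucc_lt_last i).ne)
    have hfirst : ∀ k, k ≠ Fin.last q → φ (τ.initial (τ.toFun (τ.a k))) ∈ N := by
      intro k hk
      have := N.sub_mem (hdiff k hk) (hdiff i₀ hil)
      rwa [sub_sub_sub_cancel_right, h0, sub_zero] at this
    refine ⟨hfirst, fun h k => ?_⟩
    rcases Fin.eq_castSucc_or_eq_last k with ⟨i, rfl⟩ | rfl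
    · exact hfirst _ (Fin.castSucc_lt_last i).ne
    · rcases Fin.eq_zero_or_eq_succ (Fin.last q) with h' | ⟨i, hi⟩
      · exact absurd (congrArg τ.a h') (by rw [τ.a_last, τ.a_zero]; exact one_ne_zero)
      · rw [hi]
        have := N.add_mem (key i (h _)) (hfirst _ (Fin.castSucc_lt_last i).ne)
        rwa [sub_add_cancel] at this
  -- Here 1 = τ(a_{j₀}) with j₀ < q, so the unconditional part applies.
  have h1 : φ (τ.initial 1) ∈ N := hj₀ ▸ himg.1 j₀ hjl
  have ha : ∀ k, φ (τ.initial (τ.a k)) ∈ N := by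
    intro k
    by_cases hk : k = Fin.last q
    · rw [hk, τ.a_last]; exact h1
    · exact hN k hk
  -- Each c is compared with the left end of its lap. Minimality of I₁ then carries membership from
  -- the partition points to every c.
  have hiff : ∀ c ∈ τ.generalizedOrbit,
      (φ (τ.initial c) ∈ N ↔ φ (τ.initial (τ.toFun c)) ∈ N) := by
    intro c hc
    obtain ⟨i, hi⟩ := τ.exists_mem_lap c
    rw [← N.sub_mem_iff_left (ha i.castSucc), hrel i _ (τ.a_mem _) c hc (hl i) hi,
      N.sub_mem_iff_left (himg.2 ha _)]
  have hall : ∀ c ∈ τ.generalizedOrbit, φ (τ.initial c) ∈ N := by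
    intro c hc
    refine (mem_sInter.1 hc {c | c ∈ τ.generalizedOrbit ∧ φ (τ.initial c) ∈ N} ⟨?_, ?_, ?_⟩).2
    · rintro _ ⟨k, rfl⟩
      exact ⟨τ.a_mem k, ha k⟩
    · rintro _ ⟨c, ⟨hc, h⟩, rfl⟩
      exact ⟨τ.map_mem hc, (hiff c hc).1 h⟩
    · rintro c ⟨hc, h⟩
      have hc' := τ.mem_of_map_mem hc
      exact ⟨hc', (hiff c hc').2 h⟩
  rw [map_eq_stepHom (h0 := τ.zero_mem) τ.one_mem, stepHom_apply]
  refine N.sub_mem (N.toAddSubgroup.zsmul_mem h1 _) (N.sum_mem fun c hc => ?_)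
  exact N.toAddSubgroup.zsmul_mem
    (hall c (mem_of_jump_ne_zero (Finsupp.mem_support_iff.1 hc)).1) _

/-- Only three properties of the class map enter: it is surjective, it turns 𝓛 into t, and its
kernel consists of functions killed by a power of 𝓛. -/
lemma exists_basis (hs : Surjective τ.toFun)
    (horb_inf : ∀ i : Fin (q + 1), i ≠ 0 → i ≠ Fin.last q →
      (forwardOrbit τ.toFun (τ.a i)).Infinite)
    (horb_disj : ∀ i j : Fin (q + 1), i ≠ 0 → i ≠ Fin.last q → j ≠ 0 → j ≠ Fin.last q → i ≠ j →
      Disjoint (forwardOrbit τ.toFun (τ.a i)) (forwardOrbit τ.toFun (τ.a j)))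
    (h01 : τ.toFun '' {0, 1} ∩ {0, 1} = ∅) (hsurj : Surjective φ)
    (hφ : ∀ f, φ (τ.isPiecewiseHomeo_localHomeo.transfer f) = (T 1 : ℤ[T;T⁻¹]) • φ f)
    (hker : ∀ f, φ f = 0 → ∃ n : ℕ, τ.isPiecewiseHomeo_localHomeo.transfer^[n] f = 0)
    {l r : Fin (q - 1) → Fin (q + 1)} (hl : ∀ i, (l i : ℕ) = i) (hr : ∀ i, (r i : ℕ) = i + 1) :
    ∃ b : Module.Basis (Fin (q - 1)) ℤ[T;T⁻¹] G, ∀ i : Fin (q - 1),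
      b i = φ (τ.initial (τ.a (r i)) - τ.initial (τ.a (l i))) := by
  -- `s k` sums the first `k` standard vectors, so consecutive differences below the last index are
  -- the standard basis. The resulting `v` need not agree with `s` at `Fin.last q`.
  let s : Fin (q + 1) → Fin (q - 1) → ℤ[T;T⁻¹] := fun k j => if (j : ℕ) < k then 1 else 0
  obtain ⟨v, hv0, hvs, hv⟩ := τ.exists_equivariant_values hs horb_inf horb_disj h01 s
    (by funext j; simp [s])
  let ψ : C(τ.Space, ℤ) →+ (Fin (q - 1) → ℤ[T;T⁻¹]) := stepHom v
  have hψi : ∀ c ∈ τ.generalizedOrbit, ψ (τ.initial c) = v c := fun c hc =>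
    stepHom_initialChar hv0 hc
  have hψ : ∀ f, ψ (τ.isPiecewiseHomeo_localHomeo.transfer f) = (T 1 : ℤ[T;T⁻¹]) • ψ f := by
    let g : C(τ.Space, ℤ) →+ (Fin (q - 1) → ℤ[T;T⁻¹]) :=
      ψ.comp τ.isPiecewiseHomeo_localHomeo.transfer
    let h : C(τ.Space, ℤ) →+ (Fin (q - 1) → ℤ[T;T⁻¹]) :=
      (DistribSMul.toAddMonoidHom _ (T 1 : ℤ[T;T⁻¹])).comp ψ
    -- Both sides vanish at c = 0 and have equal differences on each lap, by the equivariance of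
    -- `v`.
    have hgh : ∀ c ∈ τ.generalizedOrbit, g (τ.initial c) = h (τ.initial c) := by
      refine fun c hc => τ.eqOn_of_sub_eq_sub (v := fun c => g (τ.initial c))
        (w := fun c => h (τ.initial c)) (by simp) (fun i c hc d hd hci hdi => ?_) hc
      rw [← map_sub, ← map_sub]
      change ψ (τ.isPiecewiseHomeo_localHomeo.transfer _) = (T 1 : ℤ[T;T⁻¹]) • ψ _
      rw [τ.transfer_initial_sub hc hd hci hdi, map_zsmul, map_sub, map_sub, hψi c hc, hψi d hd,
        hψi _ (τ.map_mem hc), hψi _ (τ.map_mem hd), hv i c hc d hd hci hdi]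
    intro f
    change g f = h f
    rw [map_eq_stepHom (h0 := τ.zero_mem) τ.one_mem g, map_eq_stepHom (h0 := τ.zero_mem)
      τ.one_mem h, stepHom_apply, stepHom_apply, hgh 1 τ.one_mem]
    congr 1
    refine Finsupp.sum_congr fun c hc => ?_
    rw [hgh c (mem_of_jump_ne_zero (Finsupp.mem_support_iff.1 hc)).1]
  -- If 𝓛ⁿf = 0 then tⁿψ(f) = 0, and t acts invertibly on the target.
  have hψker : φ.ker ≤ ψ.ker := by
    intro f hf
    obtain ⟨n, hn⟩ := hker f hf
    have hiter : ∀ (n : ℕ) f, ψ (τ.isPiecewiseHomeo_localHomeo.transfer^[n] f) =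
        (T n : ℤ[T;T⁻¹]) • ψ f := by
      intro n
      induction n with
      | zero => simp
      | succ n ih =>
        intro f
        rw [iterate_succ_apply, ih, hψ, smul_smul, ← LaurentPolynomial.T_add, Nat.cast_succ]
    have h := hiter n f
    rw [hn, map_zero] at h
    have h2 := congrArg ((T (-n : ℤ) : ℤ[T;T⁻¹]) • ·) h
    simp only [smul_zero] at h2
    rw [smul_smul, ← LaurentPolynomial.T_add, neg_add_cancel, LaurentPolynomial.T_zero,
      one_smul] at h2
    exact h2.symm
  let F : G →+ (Fin (q - 1) → ℤ[T;T⁻¹]) := φ.liftOfSurjective hsurj ⟨ψ, hψker⟩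
  have hF : ∀ f, F (φ f) = ψ f := fun f => AddMonoidHom.liftOfRightInverse_comp_apply _ _ _ _ _
  let Φ : G →ₗ[ℤ[T;T⁻¹]] (Fin (q - 1) → ℤ[T;T⁻¹]) := F.toLaurentLinearMap fun x => by
    obtain ⟨f, rfl⟩ := hsurj x
    rw [← hφ, hF, hF, hψ]
  let b : Fin (q - 1) → G := fun i =>
    φ (τ.initial (τ.a (r i)) - τ.initial (τ.a (l i)))
  have hΦ : ∀ i, Φ (b i) = Pi.single i 1 := by
    intro i
    change F (φ _) = _
    rw [hF, map_sub, hψi _ (τ.a_mem _), hψi _ (τ.a_mem _),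
      hvs _ (by rw [Ne, Fin.ext_iff, Fin.val_last, hr]; omega),
      hvs _ (by rw [Ne, Fin.ext_iff, Fin.val_last, hl]; omega)]
    funext j
    simp only [s, hl, hr, Pi.sub_apply, Pi.single_apply, Fin.ext_iff]
    rcases lt_trichotomy (j : ℕ) i with h | h | h
    · simp [h, h.ne, h.trans (Nat.lt_succ_self _)]
    · simp [h]
    · simp [h.ne', h.not_gt, show ¬ (j : ℕ) < i + 1 by omega]
  have hli : LinearIndependent ℤ[T;T⁻¹] b := by
    refine LinearIndependent.of_comp Φ ?_
    have : Φ ∘ b = fun i => Pi.single i 1 := funext hΦ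
    rw [this]
    exact Pi.linearIndependent_single_one _ _
  -- For k < q the class of e_{a_k} telescopes into the first k elements of `b`.
  have hspan : ⊤ ≤ Submodule.span ℤ[T;T⁻¹] (range b) := by
    rintro x -
    obtain ⟨f, rfl⟩ := hsurj x
    refine τ.map_mem_of_initial_mem hs h01 hφ (fun k => ?_) f
    induction k using Fin.induction with
    | zero =>
      intro _
      rw [τ.a_zero, initial, initialChar_zero, map_zero]
      exact Submodule.zero_mem _
    | succ i ih =>
      intro hi
      rw [Ne, Fin.ext_iff, Fin.val_last, Fin.val_succ] at hi
      obtain ⟨j, hj⟩ : ∃ j : Fin (q - 1), (j : ℕ) = i :=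
        ⟨⟨i, by have := i.2; omega⟩, rfl⟩
      have hrj : r j = i.succ := Fin.ext (by rw [hr, hj, Fin.val_succ])
      have hlj : l j = i.castSucc := Fin.ext (by rw [hl, hj, Fin.val_castSucc])
      have := Submodule.add_mem _ (Submodule.subset_span (mem_range_self j))
        (ih (Fin.castSucc_lt_last i).ne)
      simp only [b, hrj, hlj, ← map_add] at this
      rwa [sub_add_cancel] at this
  exact ⟨Module.Basis.mk hli hspan, fun i => Module.Basis.mk_apply hli hspan i⟩

end MultimodalMap

end

/-! ### The basis of the dimension module -/

theorem proposition1p53 (q : ℕ) (τ : MultimodalMap q)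
    (hsurj : Function.Surjective τ.toFun)
    (horb_inf : ∀ i : Fin (q + 1), i ≠ 0 → i ≠ Fin.last q →
      (forwardOrbit τ.toFun (τ.a i)).Infinite)
    (horb_disj : ∀ i j : Fin (q + 1), i ≠ 0 → i ≠ Fin.last q → j ≠ 0 → j ≠ Fin.last q → i ≠ j →
      Disjoint (forwardOrbit τ.toFun (τ.a i)) (forwardOrbit τ.toFun (τ.a j)))
    (h01 : τ.toFun '' {0, 1} ∩ {0, 1} = ∅) :
    letI : Module ℤ[T;T⁻¹] τ.DG := τ.dgModule hsurj
    Nonempty (τ.DG ≃ₗ[ℤ[T;T⁻¹]] (Fin (q - 1) → ℤ[T;T⁻¹])) ∧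
    ∃ b : Module.Basis (Fin (q - 1)) ℤ[T;T⁻¹] τ.DG, ∀ i : Fin (q - 1),
      b i = τ.intervalClass (c := τ.a ⟨i, by omega⟩) (d := τ.a ⟨i + 1, by omega⟩)
        (τ.a_mem _) (τ.a_mem _) (τ.a_strictMono (Nat.lt_succ_self i)) := by
  let _ : Module ℤ[T;T⁻¹] τ.DG := τ.dgModule hsurj
  obtain ⟨b, hb⟩ := τ.exists_basis (φ := τ.isPiecewiseHomeo_localHomeo.cls) hsurj horb_inf
    horb_disj h01 τ.isPiecewiseHomeo_localHomeo.cls_surjective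
    (fun f => (τ.isPiecewiseHomeo_localHomeo.T_one_smul (τ.localHomeo_surjective hsurj)
      (τ.isPiecewiseHomeo_localHomeo.cls f)).symm)
    (fun f hf => by
      rw [← map_zero τ.isPiecewiseHomeo_localHomeo.cls,
        IsPiecewiseHomeo.cls_eq_cls] at hf
      obtain ⟨n, hn⟩ := hf
      exact ⟨n, hn.trans (iterate_map_zero _ n)⟩)
    (l := fun i => ⟨i, by omega⟩) (r := fun i => ⟨i + 1, by omega⟩) (fun _ => rfl) fun _ => rfl
  refine ⟨⟨b.equivFun⟩, b, fun i => (hb i).trans ?_⟩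
  rw [MultimodalMap.intervalClass, ← Disconnection.intervalChar_eq_sub]
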